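/- Let $G$ be a compact connected Lie group with Lie algebra $\mathfrak g$, acting smoothly on a smooth manifold $C$ (manifolds are finite-dimensional, Hausdorff, second countable, without boundary). For a $\mathbb C$-valued $2$-form $\Omega$ on a manifold $M$ put $(TM)^{\perp\Omega}=\{u\in TM:\Omega(u,v)=0\text{ for all }v\}$. A *transverse holomorphic symplectic form* on $M$ is a smooth closed $\mathbb C$-valued $2$-form $\Omega$ such that $(TM)^{\perp\Omega}$ is a (constant rank) vector subbundle of $TM$ and such that there is an almost complex structure $I$ on $T_{\mathrm{quo}}M=TM/(TM)^{\perp\Omega}$ (a smooth bundle endomorphism with $I^2=-1$, then unique) with $\operatorname{Re}\widetilde\Omega(u,v)=\operatorname{Im}\widetilde\Omega(Iu,v)$ for all $u,v$, where $\widetilde\Omega$ is the form on $T_{\mathrm{quo}}M$ descended from $\Omega$. Let $\Omega$ be a transverse holomorphic symplectic form on $C$ and suppose the action is Hamiltonian with moment map $\nu$: $\Omega$ is $G$-invariant, and $\nu:C\to\mathfrak g^*\otimes\mathbb C$ is a smooth map, equivariant for the coadjoint action, such that $\Omega(\chi_C(a),u)=\langle d\nu(u),a\rangle$ for all $a\in\mathfrak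 g$ and all tangent vectors $u$, where $\chi_C$ is the infinitesimal action. Suppose that $G$ acts freely on $\nu^{-1}(0)$ and that $0$ is a clean value of $\nu$, i.e. $\nu^{-1}(0)$ is a smooth embedded submanifold of $C$ with $T_y\nu^{-1}(0)=\ker d\nu_y$ for all $y\in\nu^{-1}(0)$. Then $\Omega|_{\nu^{-1}(0)}$ descends to a transverse holomorphic symplectic form on $C_{\mathrm{red}}=\nu^{-1}(0)/G$. That is: the orbit space $C_{\mathrm{red}}$, with the quotient topology, is Hausdorff and second countable and carries a smooth manifold structure for which the quotient map $q:\nu^{-1}(0)\to C_{\mathrm{red}}$ is a smooth submersion, and there is a unique $\mathbb C$-valued $2$-form $\Omega_{\mathrm{red}}$ on $C_{\mathrm{red}}$ with $q^*\Omega_{\mathrm{red}}=\Omega|_{\nu^{-1}(0)}$; moreover $\Omega_{\mathrm{red}}$ is a transverse holomorphic symplectic form. -/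

import Mathlib

open scoped Manifold ContDiff

noncomputable section

namespace BraneReduction

section Forms

variable {E : Type*} [NormedAddCommGroup E] [NormedSpace ℝ E]
  {M : Type*} [TopologicalSpace M] [ChartedSpace E M]
  {E' : Type*} [NormedAddCommGroup E'] [NormedSpace ℝ E']
  {N : Type*} [TopologicalSpace N] [ChartedSpace E' N]

variable (E M) in
/-- A (not necessarily smooth) `ℂ`-valued `2`-form on a manifold `M` modelled on `E`: an
alternating `ℝ`-bilinear map `T_x M × T_x M → ℂ` for each point `x`. -/
abbrev TwoForm : Type _ :=
  ∀ x : M, TangentSpace 𝓘(ℝ, E) x [⋀^Fin 2]→L[ℝ] ℂ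

/-- The pullback `f^* Ω`, given by `(f^* Ω)_x (u, v) = Ω_{f x} (df_x u, df_x v)`. -/
def TwoForm.pullback (f : M → N) (Ω : TwoForm E' N) : TwoForm E M :=
  fun x => (Ω (f x)).compContinuousLinearMap (mfderiv 𝓘(ℝ, E) 𝓘(ℝ, E') f x)

/-- The expression of `Ω` in the preferred chart `φ` at `x₀`: the pullback `(φ⁻¹)^* Ω`, a form on
the open set `φ.target` of the vector space `E` (only its values on that set are meaningful). -/
def TwoForm.inChart (Ω : TwoForm E M) (x₀ : M) : E → E [⋀^Fin 2]→L[ℝ] ℂ :=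
  TwoForm.pullback (E := E) (E' := E) (chartAt E x₀).symm Ω

/-- Smoothness of a `2`-form: its expressions in charts are smooth. -/
def TwoForm.IsSmooth (Ω : TwoForm E M) : Prop :=
  ∀ x₀ : M, ContDiffOn ℝ ∞ (Ω.inChart x₀) (chartAt E x₀).target

/-- Closedness `dΩ = 0` of a `2`-form: the exterior derivatives of its expressions in charts
vanish. (Used together with smoothness.) -/
def TwoForm.IsClosed (Ω : TwoForm E M) : Prop :=
  ∀ x₀ : M, ∀ y ∈ (chartAt E x₀).target, extDeriv (Ω.inChart x₀) y = 0

theorem TwoForm.add_right_aux {V : Type*} [AddCommGroup V] [Module ℝ V] [TopologicalSpace V]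
    (B : V [⋀^Fin 2]→L[ℝ] ℂ) (u v v' : V) : B ![u, v + v'] = B ![u, v] + B ![u, v'] := by
  have h := B.toAlternatingMap.map_update_add ![u, v] 1 v v'
  have e : ∀ w, Function.update ![u, v] 1 w = ![u, w] := fun w => by
    funext i; fin_cases i <;> rfl
  rw [e, e, e] at h
  exact h

theorem TwoForm.smul_right_aux {V : Type*} [AddCommGroup V] [Module ℝ V] [TopologicalSpace V]
    (B : V [⋀^Fin 2]→L[ℝ] ℂ) (c : ℝ) (u v : V) : B ![u, c • v] = c • B ![u, v] := by
  have h := B.toAlternatingMap.map_update_smul ![u, v] 1 c v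
  have e : ∀ w, Function.update ![u, v] 1 w = ![u, w] := fun w => by
    funext i; fin_cases i <;> rfl
  rw [e, e] at h
  exact h

/-- `Ω_x` as an `ℝ`-bilinear map `T_x M → T_x M → ℂ`. -/
def TwoForm.bilin (Ω : TwoForm E M) (x : M) :
    TangentSpace 𝓘(ℝ, E) x →ₗ[ℝ] TangentSpace 𝓘(ℝ, E) x →ₗ[ℝ] ℂ :=
  LinearMap.mk₂ ℝ (fun u v => Ω x ![u, v])
    (fun u u' v => (Ω x).toMultilinearMap.cons_add ![v] u u')
    (fun c u v => (Ω x).toMultilinearMap.cons_smul ![v] c u)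
    (fun u v v' => TwoForm.add_right_aux (Ω x) u v v')
    (fun c u v => TwoForm.smul_right_aux (Ω x) c u v)

theorem TwoForm.bilin_apply (Ω : TwoForm E M) (x : M) (u v : TangentSpace 𝓘(ℝ, E) x) :
    Ω.bilin x u v = Ω x ![u, v] := rfl

theorem TwoForm.bilin_swap (Ω : TwoForm E M) (x : M) (u v : TangentSpace 𝓘(ℝ, E) x) :
    Ω.bilin x u v = - Ω.bilin x v u := by
  have h := (Ω x).toAlternatingMap.map_swap ![v, u] (i := 0) (j := 1) (by decide)
  have e : ![v, u] ∘ Equiv.swap (0 : Fin 2) 1 = ![u, v] := by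
    funext i; fin_cases i <;> simp
  rw [e] at h
  exact h

/-- The `Ω`-orthogonal complement `(T_x M)^{⊥ Ω}` of the whole tangent space, that is
`{u | Ω(u, v) = 0 for all v}`. -/
def TwoForm.perp (Ω : TwoForm E M) (x : M) : Submodule ℝ (TangentSpace 𝓘(ℝ, E) x) :=
  LinearMap.ker (Ω.bilin x)

/-- The fibre `T_x M / (T_x M)^{⊥ Ω}` of the quotient bundle `T_quo M`. -/
abbrev TwoForm.Quo (Ω : TwoForm E M) (x : M) : Type _ :=
  TangentSpace 𝓘(ℝ, E) x ⧸ Ω.perp x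

/-- The bilinear form on `T_x M / (T_x M)^{⊥ Ω}` descended from `Ω`. -/
def TwoForm.descend (Ω : TwoForm E M) (x : M) : Ω.Quo x →ₗ[ℝ] Ω.Quo x →ₗ[ℝ] ℂ :=
  ((Ω.perp x).liftQ ((Ω.perp x).liftQ (Ω.bilin x) le_rfl).flip (by
    intro v hv
    rw [LinearMap.mem_ker]
    have h : Ω.bilin x v = 0 := hv
    refine LinearMap.ext fun q => ?_
    obtain ⟨u, rfl⟩ := (Ω.perp x).mkQ_surjective q
    change Ω.bilin x u v = 0
    rw [Ω.bilin_swap x u v, h, LinearMap.zero_apply, neg_zero])).flip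

theorem TwoForm.descend_mk (Ω : TwoForm E M) (x : M) (u v : TangentSpace 𝓘(ℝ, E) x) :
    Ω.descend x ((Ω.perp x).mkQ u) ((Ω.perp x).mkQ v) = Ω x ![u, v] := rfl

variable [IsManifold 𝓘(ℝ, E) ∞ M]

/-- `X` is smooth on `U` as a vector field. -/
def IsSmoothVectorFieldOn (X : ∀ x : M, TangentSpace 𝓘(ℝ, E) x) (U : Set M) : Prop :=
  ContMDiffOn 𝓘(ℝ, E) (𝓘(ℝ, E)).tangent ∞ (fun x => (⟨x, X x⟩ : TangentBundle 𝓘(ℝ, E) M)) U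

/-- A family of subspaces `D_x ⊆ T_x M` is a (smooth) vector subbundle of `TM`: for some rank `k`,
near every point there are `k` smooth vector fields which form a basis of `D_x` for each `x`. -/
def IsVectorSubbundle (D : ∀ x : M, Submodule ℝ (TangentSpace 𝓘(ℝ, E) x)) : Prop :=
  ∃ k : ℕ, ∀ x₀ : M, ∃ U : Set M, IsOpen U ∧ x₀ ∈ U ∧
    ∃ s : Fin k → ∀ x : M, TangentSpace 𝓘(ℝ, E) x,
      (∀ i, IsSmoothVectorFieldOn (s i) U) ∧
      ∀ x ∈ U, LinearIndependent ℝ (fun i => s i x) ∧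
        Submodule.span ℝ (Set.range fun i => s i x) = D x

/-- A fibrewise linear endomorphism `I` of `T_quo M = TM / (TM)^{⊥ Ω}` is smooth: it maps smooth
local sections to smooth local sections, where a local section of the quotient bundle is smooth
if it is locally represented by smooth vector fields. -/
def IsSmoothQuoEndomorphism (Ω : TwoForm E M) (I : ∀ x : M, Ω.Quo x →ₗ[ℝ] Ω.Quo x) : Prop :=
  ∀ (U : Set M) (X : ∀ x : M, TangentSpace 𝓘(ℝ, E) x), IsOpen U → IsSmoothVectorFieldOn X U →
    ∀ x₀ ∈ U, ∃ V : Set M, IsOpen V ∧ x₀ ∈ V ∧ V ⊆ U ∧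
      ∃ Y : ∀ x : M, TangentSpace 𝓘(ℝ, E) x, IsSmoothVectorFieldOn Y V ∧
        ∀ x ∈ V, (Ω.perp x).mkQ (Y x) = I x ((Ω.perp x).mkQ (X x))

/-- `I` is an almost complex structure on `T_quo M = TM / (TM)^{⊥ Ω}`. -/
structure IsQuoAlmostComplexStructure (Ω : TwoForm E M)
    (I : ∀ x : M, Ω.Quo x →ₗ[ℝ] Ω.Quo x) : Prop where
  smooth : IsSmoothQuoEndomorphism Ω I
  sq_eq : ∀ x u, I x (I x u) = -u

/-- Transverse holomorphic symplectic forms. The endomorphism `I` is uniquely determined by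
the condition `Re Ω(u, v) = Im Ω(I u, v)` together with `I ^ 2 = -1`. -/
structure IsTransverseHolomorphicSymplectic (Ω : TwoForm E M) : Prop where
  smooth : Ω.IsSmooth
  closed : Ω.IsClosed
  subbundle : IsVectorSubbundle Ω.perp
  almostComplex : ∃ I : ∀ x : M, Ω.Quo x →ₗ[ℝ] Ω.Quo x,
    IsQuoAlmostComplexStructure Ω I ∧
    ∀ x u v, (Ω.descend x u v).re = (Ω.descend x (I x u) v).im

end Forms

section CleanValue

variable {E : Type*} [NormedAddCommGroup E] [NormedSpace ℝ E]
  {M : Type*} [TopologicalSpace M] [ChartedSpace E M]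
  {E' : Type*} [NormedAddCommGroup E'] [NormedSpace ℝ E']
  {N : Type*} [TopologicalSpace N] [ChartedSpace E' N]

/-- `z` is a clean value of `f`, where the level set `S = f⁻¹(z)` carries the given manifold
structure (modelled on `F`): `S` is a smooth embedded submanifold of `M` and, for all `y ∈ S`,
the tangent space `T_y S ⊆ T_y M` is the kernel of `df_y`. -/
structure IsCleanValue (F : Type*) [NormedAddCommGroup F] [NormedSpace ℝ F]
    (f : M → N) (z : N) [ChartedSpace F (f ⁻¹' {z})] : Prop where
  isManifold : IsManifold 𝓘(ℝ, F) ∞ (f ⁻¹' {z})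
  isSmoothEmbedding : Manifold.IsSmoothEmbedding 𝓘(ℝ, F) 𝓘(ℝ, E) ∞
    (Subtype.val : (f ⁻¹' {z}) → M)
  range_eq_ker : ∀ y : (f ⁻¹' {z}),
    LinearMap.range (mfderiv 𝓘(ℝ, F) 𝓘(ℝ, E) (Subtype.val : (f ⁻¹' {z}) → M) y).toLinearMap =
      LinearMap.ker (mfderiv 𝓘(ℝ, E) 𝓘(ℝ, E') f (y : M)).toLinearMap

end CleanValue

section Actions

variable {EG : Type*} [NormedAddCommGroup EG] [NormedSpace ℝ EG]
  {G : Type*} [TopologicalSpace G] [ChartedSpace EG G] [Group G]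
  {E : Type*} [NormedAddCommGroup E] [NormedSpace ℝ E]
  {C : Type*} [TopologicalSpace C] [ChartedSpace E C] [MulAction G C]

/-- The adjoint action of `g` on the Lie algebra `𝔤 = T_1 G`: the derivative at `1` of
`h ↦ g h g⁻¹` (note that `T_{g 1 g⁻¹} G` is `T_1 G`). -/
def adjointAction (g : G) : GroupLieAlgebra 𝓘(ℝ, EG) G →L[ℝ] GroupLieAlgebra 𝓘(ℝ, EG) G :=
  mfderiv 𝓘(ℝ, EG) 𝓘(ℝ, EG) (fun h : G => g * h * g⁻¹) 1

/-- The infinitesimal action of `a ∈ 𝔤 = T_1 G` at `x`: the derivative at `1` of the orbit map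
`g ↦ g • x` in the direction `a`, that is `d/dt (exp (t a) • x)` at `t = 0`. -/
def infinitesimalAction (a : GroupLieAlgebra 𝓘(ℝ, EG) G) (x : C) : TangentSpace 𝓘(ℝ, E) x :=
  (mfderiv 𝓘(ℝ, EG) 𝓘(ℝ, E) (fun g : G => g • x) 1 a : E)

/-- The action of `G` on `(C, Ω)` is Hamiltonian with moment map `ν`. The space `𝔤^* ⊗ ℂ` is
identified with the space of `ℝ`-linear maps from `𝔤` to `ℂ`, where `𝔤 = T_1 G` has underlying
normed space the model space `EG`. -/
structure IsHamiltonianAction (G : Type*) [TopologicalSpace G] [ChartedSpace EG G] [Group G]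
    [MulAction G C] (Ω : TwoForm E C) (ν : C → (EG →L[ℝ] ℂ)) : Prop where
  invariant : ∀ g : G, TwoForm.pullback (fun x : C => g • x) Ω = Ω
  smooth : ContMDiff 𝓘(ℝ, E) 𝓘(ℝ, EG →L[ℝ] ℂ) ∞ ν
  /-- Equivariance for the coadjoint action on `𝔤^* ⊗ ℂ`. -/
  equivariant : ∀ (g : G) (x : C) (a : GroupLieAlgebra 𝓘(ℝ, EG) G),
    ν (g • x) a = ν x (adjointAction g⁻¹ a)
  moment : ∀ (a : GroupLieAlgebra 𝓘(ℝ, EG) G) (x : C) (u : TangentSpace 𝓘(ℝ, E) x),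
    Ω x ![infinitesimalAction a x, u] =
      NormedSpace.fromTangentSpace (ν x)
        (mfderiv 𝓘(ℝ, E) 𝓘(ℝ, EG →L[ℝ] ℂ) ν x u) a

/-- The orbit space `S / G` of a subset `S` of `C`: two points of `S` are identified if they lie
in the same `G`-orbit. It carries the quotient topology of the subspace topology of `S`. -/
abbrev OrbitSpace (G : Type*) [Group G] [MulAction G C] (S : Set C) : Type _ :=
  Quotient ((MulAction.orbitRel G C).comap (Subtype.val : S → C))

/-- The quotient map `S → S / G`. -/
def orbitMap (G : Type*) [Group G] [MulAction G C] (S : Set C) : S → OrbitSpace G S :=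
  Quotient.mk _

end Actions

end BraneReduction

end

open BraneReduction

/-! Write Z for the zero level of `ν` and, at a point of Z, A for the tangent space to the orbit.
Cleanness and the moment identity give TZ = ker dν = {u : Ω(a, u) = 0 for all a in A}. Equivariance
makes Z invariant, so A ⊆ TZ. Hence Ω restricted to Z is G-invariant and kills the orbit directions,
so it descends to the orbit space as soon as that space is a manifold with q a submersion whose
vertical vectors are exactly A.

The quotient manifold comes from slices. A free action is infinitesimally free
(`mfderiv_orbitMap_injective`), so (n, a) ↦ a • s(n), with s transverse to the orbit, is a local
diffeomorphism. Compactness of G ensures that a small slice meets each orbit at most once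
(`eventually_forall_smul_eq`). The slice parameter is then a chart of the quotient
(`exists_isAdaptedChart`, `exists_quotient_manifold`).

The reduced form is first built pointwise (`TwoForm.exists_pullback_eq`). Locally it is the pullback
of Ω along a section of q followed by the inclusion, so it is smooth and closed.

The main point is constant rank, since the dimension of A + ker Ω is not prescribed. The condition
on I amounts to Ω(Iu, v) = iΩ(u, v), so TZ, an Ω-orthogonal complement, is stable under I modulo ker
Ω. On such a subspace orthogonality for Re Ω and for Ω coincide, and A ⊆ TZ puts the orthogonal
complement of TZ inside TZ. The real dimension formula then expresses the rank of the radical on Z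
through dim Z, dim C and the rank of ker Ω only (`finrank_radical_add_finrank`). The same stability
lets multiplication by i pass to the quotient. Constant rank provides smooth generalized inverses of
u ↦ Ω(u, ·), and these make both the radical and the complex structure smooth
(`TwoForm.isTransverseHolomorphicSymplectic_of_finrank_eq`). -/

noncomputable section
namespace BraneReduction

open Module Set Filter Topology

/-! ### Smooth families of linear maps of constant rank -/

section LinearAlgebra

/-- A smooth family of linear maps of constant rank admits local smooth generalized inverses. -/
theorem exists_contDiffOn_generalizedInverse {X V W : Type*}
    [NormedAddCommGroup X] [NormedSpace ℝ X]
    [NormedAddCommGroup V] [NormedSpace ℝ V] [FiniteDimensional ℝ V]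
    [NormedAddCommGroup W] [NormedSpace ℝ W] [FiniteDimensional ℝ W]
    {B : X → V →L[ℝ] W} {U : Set X} (hU : IsOpen U) (hB : ContDiffOn ℝ ∞ B U) {k : ℕ}
    (hk : ∀ x ∈ U, finrank ℝ (LinearMap.ker (B x).toLinearMap) = k) {x₀ : X} (hx₀ : x₀ ∈ U) :
    ∃ U' ⊆ U, IsOpen U' ∧ x₀ ∈ U' ∧ ∃ R : X → W →L[ℝ] V, ContDiffOn ℝ ∞ R U' ∧
      ∀ x ∈ U', ∀ v, B x (R x (B x v)) = B x v := by
  -- Fix a complement V₁ of ker B(x₀) and a projection P onto the range of B(x₀). The compression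
  -- T(x) = P B(x)|V₁ is invertible at x₀, hence nearby, and R(x) = T(x)⁻¹ P is the candidate.
  obtain ⟨V₁, hV₁⟩ := (LinearMap.ker (B x₀).toLinearMap).exists_isCompl
  set W₁ := LinearMap.range (B x₀).toLinearMap
  obtain ⟨P₀, hP₀⟩ := W₁.exists_isCompl
  let P : W →L[ℝ] W₁ := (W₁.projectionOnto P₀ hP₀).toContinuousLinearMap
  have hP : ∀ w : W₁, P w = w := fun w => Submodule.projectionOnto_apply_left hP₀ w
  let T : X → V₁ →L[ℝ] W₁ := fun x => P ∘L (B x) ∘L V₁.subtypeL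
  have hT : ContDiffOn ℝ ∞ T U := by
    intro x hx
    exact contDiffWithinAt_const.clm_comp ((hB x hx).clm_comp contDiffWithinAt_const)
  have hT₀ : Function.Bijective (T x₀) := by
    have key : ∀ v : V₁, ((T x₀ v : W₁) : W) = B x₀ v := fun v => by
      have := hP ⟨B x₀ v, ⟨v, rfl⟩⟩
      exact congrArg Subtype.val this
    constructor
    · rw [injective_iff_map_eq_zero]
      intro v hv
      have h0 : B x₀ v = 0 := by rw [← key, hv]; rfl
      have : (v : V) ∈ LinearMap.ker (B x₀).toLinearMap ⊓ V₁ := ⟨h0, v.2⟩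
      rw [hV₁.inf_eq_bot] at this
      exact Subtype.ext this
    · rintro ⟨w, v, rfl⟩
      have hv : v ∈ LinearMap.ker (B x₀).toLinearMap ⊔ V₁ := by rw [hV₁.sup_eq_top]; trivial
      obtain ⟨a, ha, b, hb, rfl⟩ := Submodule.mem_sup.1 hv
      refine ⟨⟨b, hb⟩, Subtype.ext ?_⟩
      rw [key]
      have ha' : B x₀ a = 0 := ha
      simp [ha']
  let T₀ : V₁ ≃L[ℝ] W₁ :=
    (LinearEquiv.ofBijective (T x₀).toLinearMap hT₀).toContinuousLinearEquiv
  have hT₀' : (T₀ : V₁ →L[ℝ] W₁) = T x₀ := by ext v; rfl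
  refine ⟨U ∩ T ⁻¹' range ((↑) : (V₁ ≃L[ℝ] W₁) → V₁ →L[ℝ] W₁), inter_subset_left,
    hT.continuousOn.isOpen_inter_preimage hU ContinuousLinearEquiv.isOpen, ⟨hx₀, T₀, hT₀'⟩,
    fun x => V₁.subtypeL ∘L (T x).inverse ∘L P, ?_, ?_⟩
  · rintro x ⟨hx, e, he⟩
    have h1 : ContDiffWithinAt ℝ ∞ (fun x => (T x).inverse)
        (U ∩ T ⁻¹' range ((↑) : (V₁ ≃L[ℝ] W₁) → V₁ →L[ℝ] W₁)) x := by
      have h2 : ContDiffAt ℝ ∞ ContinuousLinearMap.inverse (T x) := by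
        rw [← he]; exact contDiffAt_map_inverse e
      exact h2.comp_contDiffWithinAt x ((hT x hx).mono inter_subset_left)
    exact contDiffWithinAt_const.clm_comp (h1.clm_comp contDiffWithinAt_const)
  · rintro x ⟨hx, e, he⟩ v
    have hinj : Function.Injective ((B x).toLinearMap ∘ₗ V₁.subtype) := by
      have : Function.Injective (T x) := by rw [← he]; exact e.injective
      exact Function.Injective.of_comp (f := P) this
    -- Constant rank enters here: B(x) is injective on V₁, whose dimension is the rank of B(x), so
    -- B(x) attains its whole range on V₁.
    have hfr : finrank ℝ V₁ = finrank ℝ (LinearMap.range (B x).toLinearMap) := by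
      have h1 := (B x).toLinearMap.finrank_range_add_finrank_ker
      have h2 := Submodule.finrank_add_eq_of_isCompl hV₁
      rw [hk x hx] at h1
      rw [hk x₀ hx₀] at h2
      omega
    have hrange : LinearMap.range ((B x).toLinearMap ∘ₗ V₁.subtype) =
        LinearMap.range (B x).toLinearMap := by
      apply Submodule.eq_of_le_of_finrank_eq (LinearMap.range_comp_le_range _ _)
      rw [LinearMap.finrank_range_of_inj hinj, hfr]
    obtain ⟨w, hw⟩ : B x v ∈ LinearMap.range ((B x).toLinearMap ∘ₗ V₁.subtype) := by
      rw [hrange]; exact ⟨v, rfl⟩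
    have hw' : B x w = B x v := hw
    have : (T x).inverse (P (B x v)) = w := by
      rw [← hw', ← he, ContinuousLinearMap.inverse_equiv]
      have : P (B x w) = e w := by
        rw [← ContinuousLinearEquiv.coe_coe, he]; rfl
      simp [this]
    simp [this, hw']

/-- The kernels of a smooth family of linear maps of constant rank have local smooth frames. -/
theorem exists_contDiffOn_ker_frame {X V W : Type*}
    [NormedAddCommGroup X] [NormedSpace ℝ X]
    [NormedAddCommGroup V] [NormedSpace ℝ V] [FiniteDimensional ℝ V]
    [NormedAddCommGroup W] [NormedSpace ℝ W] [FiniteDimensional ℝ W]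
    {B : X → V →L[ℝ] W} {U : Set X} (hU : IsOpen U) (hB : ContDiffOn ℝ ∞ B U) {k : ℕ}
    (hk : ∀ x ∈ U, finrank ℝ (LinearMap.ker (B x).toLinearMap) = k) {x₀ : X} (hx₀ : x₀ ∈ U) :
    ∃ U' ⊆ U, IsOpen U' ∧ x₀ ∈ U' ∧ ∃ s : Fin k → X → V, (∀ i, ContDiffOn ℝ ∞ (s i) U') ∧
      ∀ x ∈ U', LinearIndependent ℝ (fun i => s i x) ∧
        Submodule.span ℝ (range fun i => s i x) = LinearMap.ker (B x).toLinearMap := by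
  obtain ⟨U', hU'U, hU'o, hx₀', R, hR, hBRB⟩ := exists_contDiffOn_generalizedInverse hU hB hk hx₀
  let b := finBasisOfFinrankEq ℝ _ (hk x₀ hx₀)
  -- The correction by R lands in the kernel because B R B = B, and it vanishes at x₀, where s is
  -- the chosen basis of the kernel. Linear independence persists nearby because it is an open
  -- condition.
  let s : Fin k → X → V := fun i x => (b i : V) - R x (B x (b i))
  have hs : ∀ i, ContDiffOn ℝ ∞ (s i) U' := fun i =>
    contDiffOn_const.sub (hR.clm_apply ((hB.mono hU'U).clm_apply contDiffOn_const))
  have hli : LinearIndependent ℝ (fun i => s i x₀) := by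
    have h0 : (fun i => s i x₀) = fun i => (b i : V) := by
      funext i
      have : B x₀ (b i) = 0 := (b i).2
      simp [s, this]
    rw [h0]
    exact b.linearIndependent.map' (Submodule.subtype _) (Submodule.ker_subtype _)
  have hcont : ContinuousOn (fun x i => s i x) U' :=
    continuousOn_pi.2 fun i => (hs i).continuousOn
  refine ⟨U' ∩ (fun x i => s i x) ⁻¹' {f | LinearIndependent ℝ f}, inter_subset_left.trans hU'U,
    hcont.isOpen_inter_preimage hU'o isOpen_setOfPred_linearIndependent, ⟨hx₀', hli⟩, s,
    fun i => (hs i).mono inter_subset_left, ?_⟩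
  rintro x ⟨hx, hlix⟩
  refine ⟨hlix, ?_⟩
  apply Submodule.eq_of_le_of_finrank_eq
  · rw [Submodule.span_le]
    rintro _ ⟨i, rfl⟩
    change B x (s i x) = 0
    simp [s, hBRB x hx]
  · rw [finrank_span_eq_card hlix, hk x (hU'U hx), Fintype.card_fin]

end LinearAlgebra

end BraneReduction
end

noncomputable section
namespace BraneReduction

open Module Set Filter Topology

/-! ### Free actions are infinitesimally free -/

section OrbitMap

variable {EG : Type*} [NormedAddCommGroup EG] [NormedSpace ℝ EG] [FiniteDimensional ℝ EG]
  {G : Type*} [TopologicalSpace G] [ChartedSpace EG G] [Group G] [LieGroup 𝓘(ℝ, EG) ∞ G]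
  {E : Type*} [NormedAddCommGroup E] [NormedSpace ℝ E]
  {Z : Type*} [TopologicalSpace Z] [ChartedSpace E Z] [IsManifold 𝓘(ℝ, E) ∞ Z]
  [MulAction G Z] [ContMDiffSMul 𝓘(ℝ, EG) 𝓘(ℝ, E) ∞ G Z]

omit [FiniteDimensional ℝ EG] [LieGroup 𝓘(ℝ, EG) ∞ G] [IsManifold 𝓘(ℝ, E) ∞ Z] in
theorem contMDiff_smul_const (y : Z) : ContMDiff 𝓘(ℝ, EG) 𝓘(ℝ, E) ∞ (fun g : G => g • y) :=
  ContMDiff.smul (I := 𝓘(ℝ, EG)) (I' := 𝓘(ℝ, E)) (f := id) (g := fun _ => y)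
    contMDiff_id contMDiff_const

/-- A curve in a manifold whose velocity vanishes near `t₀` is constant near `t₀`. -/
theorem eventually_eq_of_hasMFDerivAt_zero {h : ℝ → Z} {t₀ : ℝ}
    (hh : ∀ᶠ t in 𝓝 t₀, HasMFDerivAt 𝓘(ℝ, ℝ) 𝓘(ℝ, E) h t
      (0 : TangentSpace 𝓘(ℝ, ℝ) t →L[ℝ] TangentSpace 𝓘(ℝ, E) (h t))) :
    ∀ᶠ t in 𝓝 t₀, h t = h t₀ := by
  have hc : ContinuousAt h t₀ := hh.self_of_nhds.continuousAt
  have hsrc : ∀ᶠ t in 𝓝 t₀, h t ∈ (chartAt E (h t₀)).source :=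
    hc.eventually ((chartAt E (h t₀)).open_source.mem_nhds (mem_chart_source E (h t₀)))
  obtain ⟨ε, hε, hball⟩ := Metric.eventually_nhds_iff_ball.1 (hh.and hsrc)
  have hder : ∀ t ∈ Metric.ball t₀ ε,
      HasFDerivAt (fun t => extChartAt 𝓘(ℝ, E) (h t₀) (h t)) (0 : ℝ →L[ℝ] E) t := by
    intro t ht
    have h1 := (mdifferentiableAt_extChartAt (I := 𝓘(ℝ, E)) (hball t ht).2).hasMFDerivAt
    have h2 := (h1.comp t (hball t ht).1).hasFDerivAt
    have e : (mfderiv 𝓘(ℝ, E) 𝓘(ℝ, E) (extChartAt 𝓘(ℝ, E) (h t₀)) (h t)).comp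
      (0 : TangentSpace 𝓘(ℝ, ℝ) t →L[ℝ] TangentSpace 𝓘(ℝ, E) (h t)) = 0 :=
      ContinuousLinearMap.comp_zero _
    rw [e] at h2
    exact h2
  refine Metric.eventually_nhds_iff_ball.2 ⟨ε, hε, fun t ht => ?_⟩
  have := (convex_ball t₀ ε).is_const_of_fderivWithin_eq_zero (𝕜 := ℝ)
    (f := fun t => extChartAt 𝓘(ℝ, E) (h t₀) (h t))
    (fun t ht => (hder t ht).differentiableAt.differentiableWithinAt)
    (fun t ht => (hder t ht).hasFDerivWithinAt.fderivWithin
      (Metric.isOpen_ball.uniqueDiffWithinAt ht)) ht (Metric.mem_ball_self hε)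
  apply (extChartAt 𝓘(ℝ, E) (h t₀)).injOn _ _ this
  · rw [extChartAt_source]; exact (hball t ht).2
  · exact mem_extChartAt_source _

/-- The derivative at `1` of the orbit map through a point with trivial stabilizer is injective. -/
theorem mfderiv_orbitMap_injective {y : Z} (hy : ∀ g : G, g • y = y → g = 1) :
    Function.Injective (mfderiv 𝓘(ℝ, EG) 𝓘(ℝ, E) (fun g : G => g • y) 1) := by
  -- If a is killed, integrate the left-invariant field of a to a curve γ through 1. The curve γ(t)
  -- • y has zero velocity, so it is constant; the trivial stabilizer forces γ = 1 near 0, and its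
  -- velocity a is 0.
  rw [injective_iff_map_eq_zero]
  intro a ha
  have : IsManifold 𝓘(ℝ, EG) ∞ G := inferInstance
  have : LieGroup 𝓘(ℝ, EG) (minSmoothness ℝ 3) G := by
    rw [minSmoothness_of_isRCLikeNormedField]
    exact LieGroup.of_le (n := ∞) ENat.LEInfty.out
  have : IsManifold 𝓘(ℝ, EG) 1 G := IsManifold.of_le (n := ∞) ENat.LEInfty.out
  have hV : ContMDiffAt 𝓘(ℝ, EG) 𝓘(ℝ, EG).tangent 1
      (fun g => (⟨g, mulInvariantVectorField a g⟩ : TangentBundle 𝓘(ℝ, EG) G)) 1 :=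
    (contMDiffAt_mulInvariantVectorField (I := 𝓘(ℝ, EG)) a).of_le (by
      rw [minSmoothness_of_isRCLikeNormedField]; exact_mod_cast one_le_two)
  have : CompleteSpace EG := FiniteDimensional.complete ℝ EG
  obtain ⟨γ, hγ0, hγ⟩ := exists_isMIntegralCurveAt_of_contMDiffAt_boundaryless 0 hV
  -- The orbit map intertwines left multiplication by g with the action of g, so vanishing at 1
  -- spreads to the left-invariant field at every g.
  have hzero : ∀ g : G, mfderiv 𝓘(ℝ, EG) 𝓘(ℝ, E) (fun k : G => k • y) g
      (mulInvariantVectorField a g) = 0 := by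
    intro g
    have hL : MDifferentiableAt 𝓘(ℝ, EG) 𝓘(ℝ, EG) (fun k : G => g * k) 1 :=
      (contMDiff_mul_left (I := 𝓘(ℝ, EG)) (n := ∞)).mdifferentiable (by simp) _
    have ho : ∀ k, MDifferentiableAt 𝓘(ℝ, EG) 𝓘(ℝ, E) (fun k : G => k • y) k := fun k =>
      (contMDiff_smul_const y).mdifferentiable (by simp) k
    have hg : MDifferentiableAt 𝓘(ℝ, E) 𝓘(ℝ, E) (fun z : Z => g • z) ((1 : G) • y) :=
      (ContMDiffSMul.contMDiff_const_smul (I := 𝓘(ℝ, EG)) (n := ∞) g).mdifferentiable (by simp) _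
    have e1 := mfderiv_comp_apply (1 : G) (ho (g * 1)) hL a
    have e2 := mfderiv_comp_apply (1 : G) hg (ho 1) a
    have e3 : (fun k : G => k • y) ∘ (fun k : G => g * k) =
      (fun z : Z => g • z) ∘ (fun k : G => k • y) := by funext k; exact mul_smul g k y
    rw [e3, e2, ha, map_zero] at e1
    -- The points g * 1 and g are only propositionally equal, so the base point is generalized
    -- before substituting; this transports the statement between tangent spaces.
    have key : ∀ g', g' = g * 1 → ∀ w : EG, w = mfderiv 𝓘(ℝ, EG) 𝓘(ℝ, EG) (fun k : G => g * k) 1 a →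
        mfderiv 𝓘(ℝ, EG) 𝓘(ℝ, E) (fun k : G => k • y) g' w = (0 : E) := by
      rintro _ rfl _ rfl
      exact e1.symm
    exact key g (mul_one g).symm _ rfl
  have hconst : ∀ᶠ t in 𝓝 (0 : ℝ), γ t • y = γ 0 • y := by
    apply eventually_eq_of_hasMFDerivAt_zero (h := fun t => γ t • y) (E := E)
    filter_upwards [hγ] with t ht
    have ht' := ((contMDiff_smul_const (EG := EG) (G := G) (E := E) y).mdifferentiable
      (by simp) (γ t)).hasMFDerivAt
    have := ht'.comp t ht
    refine this.congr_mfderiv (ContinuousLinearMap.ext fun (c : ℝ) => ?_)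
    change mfderiv 𝓘(ℝ, EG) 𝓘(ℝ, E) (fun k : G => k • y) (γ t)
      (c • mulInvariantVectorField a (γ t)) = 0
    rw [map_smul, hzero, smul_zero]
  have hone : γ =ᶠ[𝓝 0] fun _ => (1 : G) := by
    filter_upwards [hconst] with t ht
    rw [hγ0, one_smul] at ht
    exact hy _ ht
  have h1 := hγ.self_of_nhds
  have h2 := (hasMFDerivAt_const (I := 𝓘(ℝ, ℝ)) (I' := 𝓘(ℝ, EG)) (1 : G) (0 : ℝ)).congr_of_eventuallyEq hone
  have h3 : ((1 : ℝ →L[ℝ] ℝ).smulRight (mulInvariantVectorField a (γ 0)) : ℝ →L[ℝ] EG) = 0 :=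
    hasMFDerivAt_unique h1 h2
  have h4 : (mulInvariantVectorField a (γ 0) : EG) = 0 := by
    have h := congrArg (fun f : ℝ →L[ℝ] EG => f 1) h3
    change (1 : ℝ) • (mulInvariantVectorField a (γ 0) : EG) = 0 at h
    rwa [one_smul] at h
  rw [hγ0] at h4
  have h5 : (fun k : G => 1 * k) = id := by funext k; exact one_mul k
  rw [mulInvariantVectorField, h5, mfderiv_id] at h4
  exact h4

end OrbitMap

end BraneReduction
end

noncomputable section
namespace BraneReduction

open Module Set Filter Topology

/-! ### Inverse function theorem into a manifold, and charts adapted to a quotient map -/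

section InverseFunction

variable {X : Type*} [NormedAddCommGroup X] [NormedSpace ℝ X] [CompleteSpace X]
  {E : Type*} [NormedAddCommGroup E] [NormedSpace ℝ E]
  {Z : Type*} [TopologicalSpace Z] [ChartedSpace E Z] [IsManifold 𝓘(ℝ, E) ∞ Z]

/-- Inverse function theorem for smooth maps from an open subset of a Banach space to a manifold. -/
theorem exists_openPartialHomeomorph_of_hasFDerivAt_equiv {f : X → Z} {U : Set X} (hU : IsOpen U)
    (hf : ContMDiffOn 𝓘(ℝ, X) 𝓘(ℝ, E) ∞ f U) {a : X} (ha : a ∈ U) (f' : X ≃L[ℝ] E)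
    (hf' : HasFDerivAt (fun x => chartAt E (f a) (f x)) (f' : X →L[ℝ] E) a) :
    ∃ e : OpenPartialHomeomorph X Z, a ∈ e.source ∧ e.source ⊆ U ∧ EqOn e f e.source ∧
      ContMDiffOn 𝓘(ℝ, E) 𝓘(ℝ, X) ∞ e.symm e.target := by
  set φ := chartAt E (f a) with hφ
  let F : X → E := fun x => φ (f x)
  let U₁ := U ∩ f ⁻¹' φ.source
  have hU₁ : IsOpen U₁ := hf.continuousOn.isOpen_inter_preimage hU φ.open_source
  have haU₁ : a ∈ U₁ := ⟨ha, mem_chart_source E (f a)⟩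
  have hF : ContDiffOn ℝ ∞ F U₁ := by
    rw [← contMDiffOn_iff_contDiffOn]
    exact (contMDiffOn_chart (I := 𝓘(ℝ, E))).comp (hf.mono inter_subset_left) inter_subset_right
  -- Shrinking to the open set where the derivative is invertible makes the local inverse smooth on
  -- its whole domain, not just at the image of a.
  let U₂ := U₁ ∩ fderiv ℝ F ⁻¹' range ((↑) : (X ≃L[ℝ] E) → X →L[ℝ] E)
  have hU₂ : IsOpen U₂ := (hF.continuousOn_fderiv_of_isOpen hU₁ (by simp)).isOpen_inter_preimage
    hU₁ ContinuousLinearEquiv.isOpen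
  have haU₂ : a ∈ U₂ := ⟨haU₁, f', hf'.fderiv.symm⟩
  have hFa : ContDiffAt ℝ ∞ F a := hF.contDiffAt (hU₁.mem_nhds haU₁)
  let H := hFa.toOpenPartialHomeomorph F hf' (by simp)
  let H' := H.restrOpen U₂ hU₂
  have hH' : H'.source = H.source ∩ U₂ := H.restrOpen_source U₂ hU₂
  let e := H'.trans φ.symm
  have hes : ∀ x ∈ e.source, x ∈ U₂ := fun x hx => by
    have : x ∈ H'.source := by
      have := hx; rw [OpenPartialHomeomorph.trans_source] at this; exact this.1
    rw [hH'] at this; exact this.2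
  refine ⟨e, ?_, fun x hx => (hes x hx).1.1, fun x hx => ?_, ?_⟩
  · rw [OpenPartialHomeomorph.trans_source, hH']
    exact ⟨⟨hFa.mem_toOpenPartialHomeomorph_source hf' (by simp), haU₂⟩,
      φ.map_source (mem_chart_source E (f a))⟩
  · exact φ.left_inv (hes x hx).1.2
  · intro z hz
    rw [OpenPartialHomeomorph.trans_target] at hz
    have hz1 : z ∈ φ.source := hz.1
    have hz2 : φ z ∈ H'.target := hz.2
    have hx : H'.symm (φ z) ∈ U₂ := by
      have := H'.map_target hz2
      rw [hH'] at this; exact this.2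
    obtain ⟨ex, hex⟩ := hx.2
    have hFx : ContDiffAt ℝ ∞ F (H'.symm (φ z)) := hF.contDiffAt (hU₁.mem_nhds hx.1)
    have h1 : ContDiffAt ℝ ∞ H'.symm (φ z) := by
      apply H'.contDiffAt_symm hz2 (f₀' := ex)
      · rw [hex]
        exact (hFx.differentiableAt (by simp)).hasFDerivAt
      · exact hFx
    have h2 : ContMDiffAt 𝓘(ℝ, E) 𝓘(ℝ, E) ∞ φ z :=
      (contMDiffOn_chart (I := 𝓘(ℝ, E))).contMDiffAt (φ.open_source.mem_nhds hz1)
    exact (h1.contMDiffAt.comp z h2).contMDiffWithinAt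

end InverseFunction

/-- A chart `e : N × K ⊇ V → Z` is adapted to `q : Z → Q` if it is smooth, with smooth inverse, if
its first component distinguishes the fibres of `q`, and if its source is a union of slices through
points of `N × {base}`. -/
structure IsAdaptedChart {N K E Z Q : Type*} [NormedAddCommGroup N] [NormedSpace ℝ N]
    [NormedAddCommGroup K] [NormedSpace ℝ K] [NormedAddCommGroup E] [NormedSpace ℝ E]
    [TopologicalSpace Z] [ChartedSpace E Z] (q : Z → Q)
    (e : OpenPartialHomeomorph (N × K) Z) (base : K) : Prop where
  smooth : ContMDiffOn 𝓘(ℝ, N × K) 𝓘(ℝ, E) ∞ e e.source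
  smooth_symm : ContMDiffOn 𝓘(ℝ, E) 𝓘(ℝ, N × K) ∞ e.symm e.target
  eq_iff : ∀ p ∈ e.source, ∀ p' ∈ e.source, q (e p) = q (e p') ↔ p.1 = p'.1
  base_mem : ∀ p ∈ e.source, (p.1, base) ∈ e.source

/-- If `s` is a continuous family of points of `Z` with `s n₀` having trivial stabilizer, then
elements of `G` mapping a point `s n` to a point `s n'` with `n`, `n'` near `n₀` are close to `1`. -/
theorem eventually_forall_smul_eq {G Z N : Type*} [TopologicalSpace G] [CompactSpace G] [Group G]
    [TopologicalSpace Z] [T2Space Z] [MulAction G Z] [ContinuousSMul G Z]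
    [TopologicalSpace N] {s : N → Z} {n₀ : N} (hs : ContinuousAt s n₀)
    (hfree : ∀ g : G, g • s n₀ = s n₀ → g = 1) {W : Set (N × G)} (hW : W ∈ 𝓝 (n₀, (1 : G))) :
    ∀ᶠ p : N × N in 𝓝 (n₀, n₀), ∀ g : G, g • s p.1 = s p.2 → (p.1, g) ∈ W := by
  suffices ∀ᶠ p : N × N in 𝓝 (n₀, n₀), ∀ g ∈ (univ : Set G), g • s p.1 = s p.2 → (p.1, g) ∈ W by
    simpa using this
  -- Compactness of G reduces the claim to a neighbourhood of each single g. Near g = 1 the set W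
  -- does the job; for g ≠ 1 the points g • s n₀ and s n₀ differ, so by the Hausdorff property the
  -- equation has no solution nearby.
  apply isCompact_univ.eventually_forall_of_forall_eventually
  intro g _
  by_cases hg : g = 1
  · subst hg
    have : Tendsto (fun z : (N × N) × G => (z.1.1, z.2)) (𝓝 ((n₀, n₀), 1)) (𝓝 (n₀, 1)) :=
      Continuous.tendsto' (by fun_prop) _ _ rfl
    filter_upwards [this hW] with z hz _ using hz
  · have h1 : ContinuousAt (fun z : (N × N) × G => z.2 • s z.1.1) ((n₀, n₀), g) :=
      ContinuousAt.smul (by fun_prop)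
        (ContinuousAt.comp (f := fun z : (N × N) × G => z.1.1) hs (by fun_prop))
    have h2 : ContinuousAt (fun z : (N × N) × G => s z.1.2) ((n₀, n₀), g) :=
      ContinuousAt.comp (f := fun z : (N × N) × G => z.1.2) hs (by fun_prop)
    filter_upwards [(h1.ne_iff_eventually_ne h2).1 (fun h => hg (hfree g h))] with z hz h
    exact absurd h hz

/-! ### Slice charts for a free action of a compact Lie group -/

section AdaptedChart

variable {EG : Type*} [NormedAddCommGroup EG] [NormedSpace ℝ EG] [FiniteDimensional ℝ EG]
  {G : Type*} [TopologicalSpace G] [ChartedSpace EG G] [Group G] [LieGroup 𝓘(ℝ, EG) ∞ G]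
  [CompactSpace G]
  {E : Type*} [NormedAddCommGroup E] [NormedSpace ℝ E] [FiniteDimensional ℝ E]
  {Z : Type*} [TopologicalSpace Z] [T2Space Z] [ChartedSpace E Z] [IsManifold 𝓘(ℝ, E) ∞ Z]
  [MulAction G Z] [ContMDiffSMul 𝓘(ℝ, EG) 𝓘(ℝ, E) ∞ G Z]

omit [CompactSpace G] [FiniteDimensional ℝ E] [T2Space Z] in
/-- The derivative at `1` of the orbit map of a point with trivial stabilizer, in charts, is
injective. -/
theorem fderiv_chart_orbitMap_injective {y : Z} (hy : ∀ g : G, g • y = y → g = 1) :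
    Function.Injective
      (fderiv ℝ (fun a : EG => chartAt E y ((chartAt EG (1 : G)).symm a • y))
        (chartAt EG (1 : G) 1)) := by
  set ψ := chartAt EG (1 : G)
  set φ := chartAt E y
  have hψ1 : (1 : G) ∈ ψ.source := mem_chart_source EG (1 : G)
  have hsymm : ψ.symm (ψ 1) = 1 := ψ.left_inv hψ1
  have hψ := (mdifferentiable_chart (I := 𝓘(ℝ, EG)) (1 : G)).symm
  have hφ := mdifferentiable_chart (I := 𝓘(ℝ, E)) y
  have h1 : HasMFDerivAt 𝓘(ℝ, EG) 𝓘(ℝ, EG) ψ.symm (ψ 1) _ :=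
    (hψ.mdifferentiableAt (ψ.map_source hψ1)).hasMFDerivAt
  have h2 : HasMFDerivAt 𝓘(ℝ, EG) 𝓘(ℝ, E) (fun g : G => g • y) (ψ.symm (ψ 1)) _ :=
    ((contMDiff_smul_const (EG := EG) (E := E) y).mdifferentiable (by simp) _).hasMFDerivAt
  have hy' : ψ.symm (ψ 1) • y = y := by rw [hsymm, one_smul]
  have h3 : HasMFDerivAt 𝓘(ℝ, E) 𝓘(ℝ, E) φ (ψ.symm (ψ 1) • y) _ :=
    (hφ.mdifferentiableAt (by rw [hy']; exact mem_chart_source E y)).hasMFDerivAt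
  have h12 : HasMFDerivAt 𝓘(ℝ, EG) 𝓘(ℝ, E) (fun a => ψ.symm a • y) (ψ 1) _ :=
    HasMFDerivAt.comp (f := ψ.symm) (ψ 1) h2 h1
  let D₁ : EG →L[ℝ] EG := mfderiv 𝓘(ℝ, EG) 𝓘(ℝ, EG) ψ.symm (ψ 1)
  let D₂ : EG →L[ℝ] E := mfderiv 𝓘(ℝ, EG) 𝓘(ℝ, E) (fun g : G => g • y) (ψ.symm (ψ 1))
  let D₃ : E →L[ℝ] E := mfderiv 𝓘(ℝ, E) 𝓘(ℝ, E) φ (ψ.symm (ψ 1) • y)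
  have h : HasFDerivAt (fun a => φ (ψ.symm a • y)) (D₃ ∘L D₂ ∘L D₁) (ψ 1) :=
    (HasMFDerivAt.comp (f := fun a => ψ.symm a • y) (ψ 1) h3 h12).hasFDerivAt
  have hi1 := hψ.mfderiv_injective (ψ.map_source hψ1)
  have hi2 : Function.Injective
      (mfderiv 𝓘(ℝ, EG) 𝓘(ℝ, E) (fun g : G => g • y) (ψ.symm (ψ 1))) := by
    rw [hsymm]; exact mfderiv_orbitMap_injective hy
  have hi3 := hφ.mfderiv_injective (x := ψ.symm (ψ 1) • y)
    (by rw [hy']; exact mem_chart_source E y)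
  rw [h.fderiv]
  exact hi3.comp (hi2.comp hi1)

/-- Around a point with trivial stabilizer there is a chart adapted to the orbit map of the action
of a compact Lie group. -/
theorem exists_isAdaptedChart {Q : Type*} {q : Z → Q}
    (hq : ∀ z z', q z = q z' ↔ ∃ g : G, g • z = z')
    {N : Type*} [NormedAddCommGroup N] [NormedSpace ℝ N] [FiniteDimensional ℝ N]
    (hN : finrank ℝ N + finrank ℝ EG = finrank ℝ E) (y : Z) (hy : ∀ g : G, g • y = y → g = 1) :
    ∃ (e : OpenPartialHomeomorph (N × EG) Z) (base : EG), y ∈ e.target ∧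
      IsAdaptedChart (E := E) q e base := by
  have : ContinuousSMul G Z := ContMDiffSMul.continuousSMul (I := 𝓘(ℝ, EG)) (I' := 𝓘(ℝ, E)) ∞
  have hCS : CompleteSpace (N × EG) := FiniteDimensional.complete ℝ _
  have hinj := fderiv_chart_orbitMap_injective (EG := EG) (E := E) hy
  set ψ := chartAt EG (1 : G)
  set φ := chartAt E y
  set D := fderiv ℝ (fun a : EG => φ (ψ.symm a • y)) (ψ 1)
  have hψ1 : (1 : G) ∈ ψ.source := mem_chart_source EG (1 : G)
  have hsymm : ψ.symm (ψ 1) = 1 := ψ.left_inv hψ1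
  have hφy : y ∈ φ.source := mem_chart_source E y
  obtain ⟨A, hA⟩ := (LinearMap.range D.toLinearMap).exists_isCompl
  have hfr : finrank ℝ N = finrank ℝ A := by
    have h1 := Submodule.finrank_add_eq_of_isCompl hA
    rw [LinearMap.finrank_range_of_inj hinj] at h1
    omega
  let L₀ : N ≃ₗ[ℝ] A := LinearEquiv.ofFinrankEq N A hfr
  let L : N →L[ℝ] E := (A.subtype ∘ₗ L₀.toLinearMap).toContinuousLinearMap
  -- The slice is an affine subspace of the chart at y, in a direction A complementary to the
  -- tangent space of the orbit. Then f(n, a) = ψ⁻¹(a) • s(n) has derivative (n, a) ↦ L n + D a at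
  -- the centre, an isomorphism onto E.
  let s : N → Z := fun n => φ.symm (φ y + L n)
  have hs0 : s 0 = y := by simp [s, φ.left_inv hφy]
  let f : N × EG → Z := fun p => ψ.symm p.2 • s p.1
  have hf0 : f (0, ψ 1) = y := by simp [f, hs0, hsymm]
  let V₀ : Set N := {n | φ y + L n ∈ φ.target}
  have hV₀ : IsOpen V₀ := φ.open_target.preimage (by fun_prop)
  have h0V₀ : (0 : N) ∈ V₀ := by simp [V₀, φ.map_source hφy]
  have hsm : ContMDiffOn 𝓘(ℝ, N) 𝓘(ℝ, E) ∞ s V₀ :=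
    (contMDiffOn_chart_symm (I := 𝓘(ℝ, E))).comp (t := φ.target)
      (ContDiff.contMDiff (by fun_prop)).contMDiffOn (fun n hn => hn)
  let U : Set (N × EG) := V₀ ×ˢ ψ.target
  have hU : IsOpen U := hV₀.prod ψ.open_target
  have haU : ((0 : N), ψ 1) ∈ U := ⟨h0V₀, ψ.map_source hψ1⟩
  have hfU : ContMDiffOn 𝓘(ℝ, N × EG) 𝓘(ℝ, E) ∞ f U := by
    refine ContMDiffOn.smul (I := 𝓘(ℝ, EG)) (f := fun p : N × EG => ψ.symm p.2)
      (g := fun p : N × EG => s p.1) ?_ ?_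
    · exact (contMDiffOn_chart_symm (I := 𝓘(ℝ, EG))).comp (t := ψ.target)
        (ContDiff.contMDiff (by fun_prop)).contMDiffOn (fun p hp => hp.2)
    · exact hsm.comp (ContDiff.contMDiff (by fun_prop)).contMDiffOn (fun p hp => hp.1)
  have hFdiff : DifferentiableAt ℝ (fun p => φ (f p)) (0, ψ 1) := by
    rw [← mdifferentiableAt_iff_differentiableAt]
    have h1 := (hfU.contMDiffAt (hU.mem_nhds haU)).mdifferentiableAt (by simp)
    have h2 : MDifferentiableAt 𝓘(ℝ, E) 𝓘(ℝ, E) φ (f (0, ψ 1)) := by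
      rw [hf0]
      exact (mdifferentiable_chart (I := 𝓘(ℝ, E)) y).mdifferentiableAt hφy
    exact h2.comp _ h1
  set F' := fderiv ℝ (fun p => φ (f p)) (0, ψ 1)
  have hF' : HasFDerivAt (fun p => φ (f p)) F' (0, ψ 1) := hFdiff.hasFDerivAt
  have hF'1 : ∀ n : N, F' (n, 0) = L n := by
    have h1 := HasFDerivAt.comp (f := fun n : N => (n, ψ 1)) (0 : N) hF'
      (hasFDerivAt_prodMk_left (0 : N) (ψ 1))
    have h2 : HasFDerivAt (fun n : N => φ y + L n) L 0 := L.hasFDerivAt.const_add _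
    have h3 : ((fun p => φ (f p)) ∘ fun n : N => (n, ψ 1)) =ᶠ[𝓝 0] fun n => φ y + L n := by
      filter_upwards [hV₀.mem_nhds h0V₀] with n hn
      simp only [f, s, Function.comp_apply, hsymm, one_smul]
      exact φ.right_inv hn
    have h4 := h1.unique (h2.congr_of_eventuallyEq h3)
    intro n
    rw [← h4]; rfl
  have hF'2 : ∀ a : EG, F' (0, a) = D a := by
    have h1 := HasFDerivAt.comp (f := fun a : EG => ((0 : N), a)) (ψ 1) hF'
      (hasFDerivAt_prodMk_right (0 : N) (ψ 1))
    have h3 : ((fun p => φ (f p)) ∘ fun a : EG => ((0 : N), a)) = fun a => φ (ψ.symm a • y) := by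
      funext a
      simp [f, hs0]
    rw [h3] at h1
    intro a
    simp only [D, h1.fderiv]
    rfl
  have hF'3 : ∀ p : N × EG, F' p = L p.1 + D p.2 := fun p => by
    rw [← hF'1, ← hF'2, ← map_add]; simp
  have hLA : ∀ n, L n ∈ A := fun n => (L₀ n).2
  have hbij : Function.Bijective F'.toLinearMap := by
    have hi : Function.Injective F'.toLinearMap := by
      rw [injective_iff_map_eq_zero]
      intro p hp
      have hp' : L p.1 + D p.2 = 0 := by rw [← hF'3]; exact hp
      have hL0 : L p.1 = 0 := by
        have : L p.1 ∈ LinearMap.range D.toLinearMap ⊓ A :=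
          ⟨⟨-p.2, by simp [eq_neg_of_add_eq_zero_left hp']⟩, hLA _⟩
        rwa [hA.inf_eq_bot] at this
      rw [hL0, zero_add] at hp'
      refine Prod.ext ?_ ?_
      · exact L₀.map_eq_zero_iff.1 (Subtype.ext hL0)
      · exact hinj (by rw [hp']; simp)
    refine ⟨hi, ?_⟩
    rw [← LinearMap.injective_iff_surjective_of_finrank_eq_finrank]
    · exact hi
    · rw [finrank_prod, hN]
  let Fe : (N × EG) ≃L[ℝ] E := (LinearEquiv.ofBijective F'.toLinearMap hbij).toContinuousLinearEquiv
  obtain ⟨e, hae, heU, hef, hesymm⟩ := exists_openPartialHomeomorph_of_hasFDerivAt_equiv hU hfU haU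
    Fe (by rw [hf0]; exact hF')
  have hefa : ∀ p ∈ e.source, e p = ψ.symm p.2 • s p.1 := fun p hp => hef hp
  have hfree : ∀ g : G, g • s 0 = s 0 → g = 1 := by rw [hs0]; exact hy
  have hsc : ContinuousAt s 0 := hsm.continuousOn.continuousAt (hV₀.mem_nhds h0V₀)
  -- With this W, any g carrying s n to s n' for n, n' near 0 satisfies (n, ψ g) ∈ e.source. Both
  -- (n, ψ g) and (n', ψ 1) are then mapped by e to s n', so injectivity of e gives n = n'.
  have hW : {p : N × G | (p.1, ψ p.2) ∈ e.source ∧ p.2 ∈ ψ.source} ∈ 𝓝 ((0 : N), (1 : G)) := by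
    have h1 : ContinuousAt (fun p : N × G => (p.1, ψ p.2)) (0, 1) :=
      continuousAt_fst.prodMk
        (ContinuousAt.comp (f := Prod.snd) (ψ.continuousAt hψ1) continuousAt_snd)
    exact inter_mem (h1 (e.open_source.mem_nhds hae))
      (continuousAt_snd (ψ.open_source.mem_nhds hψ1))
  have hev := eventually_forall_smul_eq hsc hfree hW
  rw [nhds_prod_eq] at hev
  obtain ⟨V₁, hV₁, hV₁'⟩ := (eventually_prod_self_iff (r := fun n n' : N =>
    ∀ g : G, g • s n = s n' → (n, ψ g) ∈ e.source ∧ g ∈ ψ.source)).1 hev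
  have hb : ∀ᶠ n in 𝓝 (0 : N), (n, ψ 1) ∈ e.source :=
    (Continuous.tendsto' (f := fun n : N => (n, ψ 1)) (by fun_prop) 0 _ rfl)
      (e.open_source.mem_nhds hae)
  obtain ⟨V, hV, hVo, h0V⟩ := mem_nhds_iff.1 (inter_mem hV₁ hb)
  -- Only the slice coordinate is restricted, so the points (n, ψ 1) with n ∈ V remain in the
  -- source.
  let e' := e.restrOpen (V ×ˢ univ) (hVo.prod isOpen_univ)
  have hsrc : e'.source = e.source ∩ V ×ˢ univ := e.restrOpen_source _ _
  have he' : ∀ p, e' p = e p := fun p => rfl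
  have hmem : ((0 : N), ψ 1) ∈ e'.source := by rw [hsrc]; exact ⟨hae, h0V, trivial⟩
  refine ⟨e', ψ 1, ?_, ?_, ?_, ?_, ?_⟩
  · have := e'.map_source hmem
    rwa [he', hef hae, hf0] at this
  · rw [hsrc]
    exact (hfU.congr fun p hp => rfl).mono (inter_subset_left.trans heU) |>.congr
      fun p hp => hef hp.1
  · refine hesymm.mono fun z hz => ?_
    have := e'.map_target hz
    rw [hsrc] at this
    have hz' : e (e'.symm z) = z := e'.right_inv hz
    rw [← hz']
    exact e.map_source this.1
  · rw [hsrc]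
    rintro ⟨n, a⟩ ⟨hp, hpV, -⟩ ⟨n', a'⟩ ⟨hp', hpV', -⟩
    rw [he', he', hefa _ hp, hefa _ hp', hq]
    constructor
    · rintro ⟨g, hg⟩
      -- Cancelling the group coordinates of the two points leaves an element carrying one slice
      -- point to the other.
      have h1 : ((ψ.symm a')⁻¹ * (g * ψ.symm a)) • s n = s n' := by
        rw [mul_smul, mul_smul, hg, inv_smul_smul]
      obtain ⟨h2, h3⟩ := hV₁' n (hV hpV).1 n' (hV hpV').1 _ h1
      have h4 := hefa _ h2
      have h5 := hefa (n', ψ 1) (hV hpV').2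
      simp only [ψ.left_inv h3, h1] at h4
      simp only [hsymm, one_smul] at h5
      change n = n'
      exact congrArg Prod.fst (e.injOn h2 (hV hpV').2 (h4.trans h5.symm))
    · rintro (rfl : n = n')
      exact ⟨ψ.symm a' * (ψ.symm a)⁻¹, by rw [mul_smul, inv_smul_smul]⟩
  · rw [hsrc]
    rintro p ⟨hp, hpV, -⟩
    exact ⟨(hV hpV).2, hpV, trivial⟩

end AdaptedChart

end BraneReduction
end

noncomputable section
namespace BraneReduction

open Module Set Filter Topology

/-! ### The manifold structure on the quotient -/

section QuotientManifold

variable {N K E Z Q : Type*} [NormedAddCommGroup N] [NormedSpace ℝ N]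
  [NormedAddCommGroup K] [NormedSpace ℝ K] [NormedAddCommGroup E] [NormedSpace ℝ E]
  [TopologicalSpace Z] [ChartedSpace E Z] [TopologicalSpace Q] {q : Z → Q}

open Classical in
/-- The first component of a chart adapted to `q : Z → Q`, as a map defined on `Q`. -/
def quotientCoordinate (q : Z → Q) (e : OpenPartialHomeomorph (N × K) Z) (x : Q) : N :=
  if h : ∃ z ∈ e.target, q z = x then (e.symm h.choose).1 else 0

-- The chosen preimage is immaterial, since the first coordinate is constant on fibres inside the
-- chart. The default value 0 occurs only outside `q '' e.target`, which is the source of the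
-- induced chart.
omit [TopologicalSpace Q] in
theorem IsAdaptedChart.quotientCoordinate_apply {e : OpenPartialHomeomorph (N × K) Z} {base : K}
    (he : IsAdaptedChart (E := E) q e base) {z : Z} (hz : z ∈ e.target) :
    quotientCoordinate q e (q z) = (e.symm z).1 := by
  have h : ∃ z' ∈ e.target, q z' = q z := ⟨z, hz, rfl⟩
  rw [quotientCoordinate, dif_pos h]
  apply (he.eq_iff _ (e.map_target h.choose_spec.1) _ (e.map_target hz)).1
  rw [e.right_inv h.choose_spec.1, e.right_inv hz, h.choose_spec.2]

omit [TopologicalSpace Q] in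
theorem IsAdaptedChart.base_mem' {e : OpenPartialHomeomorph (N × K) Z} {base : K}
    (he : IsAdaptedChart (E := E) q e base) {n : N} (hn : n ∈ Prod.fst '' e.source) :
    (n, base) ∈ e.source := by
  obtain ⟨p, hp, rfl⟩ := hn
  exact he.base_mem p hp

/-- The chart of `Q` induced by a chart of `Z` adapted to an open quotient map `q : Z → Q`. -/
def IsAdaptedChart.quotientChart {e : OpenPartialHomeomorph (N × K) Z} {base : K}
    (he : IsAdaptedChart (E := E) q e base) (hq : IsOpenQuotientMap q) :
    OpenPartialHomeomorph Q N where
  toFun := quotientCoordinate q e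
  invFun n := q (e (n, base))
  source := q '' e.target
  target := Prod.fst '' e.source
  map_source' := by
    rintro _ ⟨z, hz, rfl⟩
    rw [he.quotientCoordinate_apply hz]
    exact ⟨_, e.map_target hz, rfl⟩
  map_target' n hn := ⟨_, e.map_source (he.base_mem' hn), rfl⟩
  left_inv' := by
    rintro _ ⟨z, hz, rfl⟩
    rw [he.quotientCoordinate_apply hz]
    conv_rhs => rw [← e.right_inv hz]
    exact (he.eq_iff _ (he.base_mem _ (e.map_target hz)) _ (e.map_target hz)).2 rfl
  right_inv' n hn := by
    have h := he.base_mem' hn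
    rw [he.quotientCoordinate_apply (e.map_source h), e.left_inv h]
  open_source := hq.isOpenMap _ e.open_target
  open_target := isOpenMap_fst _ e.open_source
  continuousOn_toFun := by
    rintro _ ⟨z, hz, rfl⟩
    apply ContinuousAt.continuousWithinAt
    rw [← hq.continuousAt_comp_iff]
    have h1 : ContinuousAt (fun z => (e.symm z).1) z :=
      continuousAt_fst.comp (e.continuousAt_symm hz)
    refine h1.congr ?_
    filter_upwards [e.open_target.mem_nhds hz] with w hw
    exact (he.quotientCoordinate_apply hw).symm
  continuousOn_invFun := by
    refine hq.continuous.comp_continuousOn (e.continuousOn.comp (by fun_prop) ?_)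
    exact fun n hn => he.base_mem' hn

/-- The charted space structure on the target of an open quotient map `q : Z → Q` whose charts are
induced by charts of `Z` adapted to `q`. -/
abbrev quotientChartedSpace (E : Type*) [NormedAddCommGroup E] [NormedSpace ℝ E] [ChartedSpace E Z]
    (hq : IsOpenQuotientMap q)
    (hchart : ∀ z, ∃ (e : OpenPartialHomeomorph (N × K) Z) (base : K), z ∈ e.target ∧
      IsAdaptedChart (E := E) q e base) : ChartedSpace N Q where
  atlas := {c | ∃ (e : OpenPartialHomeomorph (N × K) Z) (base : K)
    (he : IsAdaptedChart (E := E) q e base), c = he.quotientChart hq}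
  chartAt x := (hchart (Function.surjInv hq.surjective x)).choose_spec.choose_spec.2.quotientChart hq
  mem_chart_source x :=
    ⟨_, (hchart (Function.surjInv hq.surjective x)).choose_spec.choose_spec.1,
      Function.surjInv_eq hq.surjective x⟩
  chart_mem_atlas _ := ⟨_, _, _, rfl⟩

variable [IsManifold 𝓘(ℝ, E) ∞ Z]

omit [IsManifold 𝓘(ℝ, E) ∞ Z] in
/-- If the fibres of `q` are permuted transitively by smooth maps, then the charts of `Q` induced
by adapted charts are smoothly compatible. -/
theorem contDiffOn_quotientChart_trans (hq : IsOpenQuotientMap q)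
    (hsymm : ∀ z z', q z = q z' → ∃ h : Z → Z, ContMDiff 𝓘(ℝ, E) 𝓘(ℝ, E) ∞ h ∧ h z = z' ∧
      ∀ w, q (h w) = q w)
    {e e' : OpenPartialHomeomorph (N × K) Z} {base base' : K}
    (he : IsAdaptedChart (E := E) q e base) (he' : IsAdaptedChart (E := E) q e' base') :
    ContDiffOn ℝ ∞ ((he.quotientChart hq).symm.trans (he'.quotientChart hq))
      ((he.quotientChart hq).symm.trans (he'.quotientChart hq)).source := by
  rintro n hn
  rw [OpenPartialHomeomorph.trans_source] at hn
  obtain ⟨hn1, z', hz', hqz'⟩ := hn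
  have hn1 : n ∈ Prod.fst '' e.source := hn1
  have hb := he.base_mem' hn1
  -- The two charts may see the same fibre at distant points. A symmetry h carries one point to the
  -- other, and the transition map becomes the slice of e, followed by h, followed by the first
  -- coordinate of e'.symm.
  obtain ⟨h, hh, hhz, hqh⟩ := hsymm (e (n, base)) z' hqz'.symm
  apply ContDiffAt.contDiffWithinAt
  have hσ : ContMDiffAt 𝓘(ℝ, N) 𝓘(ℝ, E) ∞ (fun m => h (e (m, base))) n := by
    refine hh.contMDiffAt.comp n ?_
    exact ContMDiffAt.comp (f := fun m : N => (m, base)) n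
      (he.smooth.contMDiffAt (e.open_source.mem_nhds hb))
      (ContDiff.contMDiff (by fun_prop)).contMDiffAt
  have h1 : ContMDiffAt 𝓘(ℝ, E) 𝓘(ℝ, N × K) ∞ e'.symm (h (e (n, base))) := by
    rw [hhz]; exact he'.smooth_symm.contMDiffAt (e'.open_target.mem_nhds hz')
  have h2 : ContDiffAt ℝ ∞ (fun m => (e'.symm (h (e (m, base)))).1) n :=
    contDiff_fst.contDiffAt.comp n (h1.comp n hσ).contDiffAt
  refine h2.congr_of_eventuallyEq ?_
  have hev : ∀ᶠ m in 𝓝 n, h (e (m, base)) ∈ e'.target := by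
    apply hσ.continuousAt.eventually_mem
    rw [hhz]; exact e'.open_target.mem_nhds hz'
  filter_upwards [hev] with m hm
  change quotientCoordinate q e' (q (e (m, base))) = _
  rw [← hqh, he'.quotientCoordinate_apply hm]

/-- An open quotient map whose fibres are permuted transitively by smooth maps, and which admits
adapted charts, is a submersion for some manifold structure on its target. -/
theorem exists_quotient_manifold (hq : IsOpenQuotientMap q)
    (hsymm : ∀ z z', q z = q z' → ∃ h : Z → Z, ContMDiff 𝓘(ℝ, E) 𝓘(ℝ, E) ∞ h ∧ h z = z' ∧
      ∀ w, q (h w) = q w)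
    (hchart : ∀ z, ∃ (e : OpenPartialHomeomorph (N × K) Z) (base : K), z ∈ e.target ∧
      IsAdaptedChart (E := E) q e base) (hdim : Nonempty Z → Nonempty (E ≃L[ℝ] N × K)) :
    ∃ (_ : ChartedSpace N Q) (_ : IsManifold 𝓘(ℝ, N) ∞ Q),
      Manifold.IsSubmersionOfComplement K 𝓘(ℝ, E) 𝓘(ℝ, N) ∞ q := by
  let _ : ChartedSpace N Q := quotientChartedSpace E hq hchart
  have hM : IsManifold 𝓘(ℝ, N) ∞ Q := by
    apply isManifold_of_contDiffOn
    rintro _ _ ⟨e, base, he, rfl⟩ ⟨e', base', he', rfl⟩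
    refine (contDiffOn_quotientChart_trans hq hsymm he he').mono ?_
    simp
  refine ⟨inferInstance, hM, fun z => ?_⟩
  obtain ⟨e, base, hz, he⟩ := hchart z
  let c := he.quotientChart hq
  obtain ⟨Λ⟩ := hdim ⟨z⟩
  -- Read in the adapted chart, with E identified with N × K, the map q is the first projection.
  let φ : OpenPartialHomeomorph Z E :=
    e.symm.transHomeomorph Λ.symm.toHomeomorph
  refine Manifold.IsSubmersionAtOfComplement.mk_of_charts Λ φ c hz ⟨z, hz, rfl⟩ ?_ ?_ ?_ ?_
  · apply OpenPartialHomeomorph.mem_maximalAtlas_of_contMDiffOn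
    · exact (ContDiff.contMDiff (𝕜 := ℝ) (f := Λ.symm) (by fun_prop)).comp_contMDiffOn he.smooth_symm
    · refine he.smooth.comp (ContDiff.contMDiff (𝕜 := ℝ) (f := Λ) (by fun_prop)).contMDiffOn ?_
      exact fun v hv => hv
  · exact IsManifold.subset_maximalAtlas ⟨e, base, he, rfl⟩
  · exact fun w hw => ⟨w, hw, rfl⟩
  · intro v hv
    have hv : v ∈ φ.target := by simpa using hv
    have hv' : Λ v ∈ e.source := hv
    change quotientCoordinate q e (q (e (Λ v))) = (Λ v).1
    rw [he.quotientCoordinate_apply (e.map_source hv'), e.left_inv hv']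

end QuotientManifold

end BraneReduction
end

noncomputable section
namespace BraneReduction

open Module Set Filter Topology

/-! ### Local sections of submersions -/

section Submersion

variable {N K E Z Q : Type*} [NormedAddCommGroup N] [NormedSpace ℝ N]
  [NormedAddCommGroup K] [NormedSpace ℝ K] [NormedAddCommGroup E] [NormedSpace ℝ E]
  [TopologicalSpace Z] [ChartedSpace E Z] [TopologicalSpace Q] [ChartedSpace N Q] {q : Z → Q}

/-- Submersions have local smooth sections through every point. -/
theorem exists_local_section {z : Z}
    (h : Manifold.IsSubmersionAtOfComplement K 𝓘(ℝ, E) 𝓘(ℝ, N) ∞ q z) :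
    ∃ (U : Set Q) (σ : Q → Z), IsOpen U ∧ q z ∈ U ∧ ContMDiffOn 𝓘(ℝ, N) 𝓘(ℝ, E) ∞ σ U ∧
      σ (q z) = z ∧ ∀ x ∈ U, q (σ x) = x := by
  set φ := h.domChart
  set ψ := h.codChart
  have hφz : z ∈ φ.source := h.mem_domChart_source
  have hψz : q z ∈ ψ.source := h.mem_codChart_source
  have hw : ∀ v ∈ φ.target, ψ (q (φ.symm v)) = (h.equiv v).1 := by
    intro v hv
    exact h.writtenInCharts (by simpa using hv)
  have hsub : ∀ w ∈ φ.source, q w ∈ ψ.source := fun w hw => h.source_subset_preimage_source hw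
  -- In submersion charts q is the first projection; the section freezes the second coordinate at
  -- its value at z.
  let c := (h.equiv (φ z)).2
  let j : N → E := fun n => h.equiv.symm (n, c)
  have hj : ContDiff ℝ ∞ j := by fun_prop
  have hjz : j (ψ (q z)) = φ z := by
    have := hw _ (φ.map_source hφz)
    rw [φ.left_inv hφz] at this
    simp only [j, this, c]
    exact h.equiv.symm_apply_apply _
  have hjψ : ContMDiffOn 𝓘(ℝ, N) 𝓘(ℝ, E) ∞ (fun x => j (ψ x)) ψ.source :=
    hj.contMDiff.comp_contMDiffOn (contMDiffOn_of_mem_maximalAtlas h.codChart_mem_maximalAtlas)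
  refine ⟨ψ.source ∩ (fun x => j (ψ x)) ⁻¹' φ.target, fun x => φ.symm (j (ψ x)),
    hjψ.continuousOn.isOpen_inter_preimage ψ.open_source φ.open_target, ⟨hψz, ?_⟩, ?_, ?_, ?_⟩
  · change j (ψ (q z)) ∈ φ.target
    rw [hjz]; exact φ.map_source hφz
  · exact (contMDiffOn_symm_of_mem_maximalAtlas h.domChart_mem_maximalAtlas).comp
      (hjψ.mono inter_subset_left) inter_subset_right
  · change φ.symm (j (ψ (q z))) = z
    rw [hjz, φ.left_inv hφz]
  · rintro x ⟨hx, hx'⟩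
    apply ψ.injOn (hsub _ (φ.map_target hx')) hx
    rw [hw _ hx']
    simp [j]

/-- The derivative of a submersion is surjective. -/
theorem mfderiv_surjective_of_isSubmersionAt {z : Z}
    (h : Manifold.IsSubmersionAtOfComplement K 𝓘(ℝ, E) 𝓘(ℝ, N) ∞ q z) :
    Function.Surjective (mfderiv 𝓘(ℝ, E) 𝓘(ℝ, N) q z) := by
  obtain ⟨U, σ, hU, hz, hσ, hσz, hqσ⟩ := exists_local_section h
  have h1 : MDifferentiableAt 𝓘(ℝ, N) 𝓘(ℝ, E) σ (q z) :=
    (hσ.contMDiffAt (hU.mem_nhds hz)).mdifferentiableAt (by simp)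
  have h2 : MDifferentiableAt 𝓘(ℝ, E) 𝓘(ℝ, N) q (σ (q z)) := by
    rw [hσz]; exact h.contMDiffAt.mdifferentiableAt (by simp)
  have h3 : (q ∘ σ) =ᶠ[𝓝 (q z)] id := by
    filter_upwards [hU.mem_nhds hz] with x hx using hqσ x hx
  have key : ∀ v, mfderiv 𝓘(ℝ, E) 𝓘(ℝ, N) q (σ (q z)) (mfderiv 𝓘(ℝ, N) 𝓘(ℝ, E) σ (q z) v) =
      v := by
    intro v
    have e1 := mfderiv_comp_apply (q z) h2 h1 v
    rw [h3.mfderiv_eq, mfderiv_id] at e1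
    exact e1.symm
  have hsurj : Function.Surjective (mfderiv 𝓘(ℝ, E) 𝓘(ℝ, N) q (σ (q z))) :=
    fun v => ⟨_, key v⟩
  rwa [hσz] at hsurj

end Submersion

end BraneReduction
end

noncomputable section
namespace BraneReduction

open Module Set Filter Topology

/-! ### Smoothness of families of alternating forms, and pullbacks -/

section Alternating

variable {V : Type*} [NormedAddCommGroup V] [NormedSpace ℝ V]

theorem alternating_ext {B B' : V [⋀^Fin 2]→L[ℝ] ℂ} (h : ∀ u v, B ![u, v] = B' ![u, v]) :
    B = B' := by
  ext w
  have e : w = ![w 0, w 1] := by funext i; fin_cases i <;> rfl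
  rw [e, h]

/-- An alternating `2`-form as a bilinear map. -/
def alternatingBilin (B : V [⋀^Fin 2]→L[ℝ] ℂ) : V →ₗ[ℝ] V →ₗ[ℝ] ℂ :=
  LinearMap.mk₂ ℝ (fun u v => B ![u, v])
    (fun u u' v => B.toMultilinearMap.cons_add ![v] u u')
    (fun c u v => B.toMultilinearMap.cons_smul ![v] c u)
    (fun u v v' => TwoForm.add_right_aux B u v v')
    (fun c u v => TwoForm.smul_right_aux B c u v)

variable [FiniteDimensional ℝ V]

theorem alternating_apply_eq_sum (B : V [⋀^Fin 2]→L[ℝ] ℂ) (u v : V) :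
    B ![u, v] = ∑ i, ∑ j, (finBasis ℝ V).repr u i • (finBasis ℝ V).repr v j •
      B ![finBasis ℝ V i, finBasis ℝ V j] := by
  change alternatingBilin B u v =
    ∑ i, ∑ j, _ • _ • alternatingBilin B (finBasis ℝ V i) (finBasis ℝ V j)
  conv_lhs => rw [← (finBasis ℝ V).sum_repr u, ← (finBasis ℝ V).sum_repr v]
  rw [map_sum (alternatingBilin B), LinearMap.sum_apply]
  refine Finset.sum_congr rfl fun i _ => ?_
  rw [map_smul, LinearMap.smul_apply, map_sum, Finset.smul_sum]
  exact Finset.sum_congr rfl fun j _ => by rw [map_smul]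

/-- Evaluation on pairs of basis vectors embeds the alternating forms linearly into a
finite-dimensional space. A linear left inverse defined on that space is automatically continuous,
so smoothness can be tested entry by entry. -/
theorem contDiffAt_alternating_iff {Y : Type*} [NormedAddCommGroup Y] [NormedSpace ℝ Y]
    {f : Y → V [⋀^Fin 2]→L[ℝ] ℂ} {y : Y} :
    ContDiffAt ℝ ∞ f y ↔ ∀ u v, ContDiffAt ℝ ∞ (fun y => f y ![u, v]) y := by
  refine ⟨fun hf u v => (ContinuousAlternatingMap.apply ℝ V ℂ ![u, v]).contDiff.contDiffAt.comp y hf,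
    fun hf => ?_⟩
  let Φ : (V [⋀^Fin 2]→L[ℝ] ℂ) →ₗ[ℝ] (Fin (finrank ℝ V) × Fin (finrank ℝ V) → ℂ) :=
    { toFun := fun B p => B ![finBasis ℝ V p.1, finBasis ℝ V p.2]
      map_add' := fun _ _ => rfl
      map_smul' := fun _ _ => rfl }
  have hΦ : LinearMap.ker Φ = ⊥ := by
    rw [LinearMap.ker_eq_bot']
    intro B hB
    apply alternating_ext
    intro u v
    rw [alternating_apply_eq_sum]
    have : ∀ i j, B ![finBasis ℝ V i, finBasis ℝ V j] = 0 := fun i j => congrFun hB (i, j)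
    simp [this]
  obtain ⟨L, hL⟩ := Φ.exists_leftInverse_of_injective hΦ
  have hLc : Continuous L := LinearMap.continuous_of_finiteDimensional _
  let T : (Fin (finrank ℝ V) × Fin (finrank ℝ V) → ℂ) →L[ℝ] (V [⋀^Fin 2]→L[ℝ] ℂ) := ⟨L, hLc⟩
  have h : f = fun y => T (Φ (f y)) := by
    funext y
    exact (LinearMap.congr_fun hL (f y)).symm
  rw [h]
  refine T.contDiff.contDiffAt.comp y ?_
  exact contDiffAt_pi.2 fun p => hf _ _

theorem contDiffAt_alternating_apply {Y : Type*} [NormedAddCommGroup Y] [NormedSpace ℝ Y]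
    {f : Y → V [⋀^Fin 2]→L[ℝ] ℂ} {u v : Y → V} {y : Y} (hf : ContDiffAt ℝ ∞ f y)
    (hu : ContDiffAt ℝ ∞ u y) (hv : ContDiffAt ℝ ∞ v y) :
    ContDiffAt ℝ ∞ (fun y => f y ![u y, v y]) y := by
  have hcoord : ∀ (w : Y → V), ContDiffAt ℝ ∞ w y → ∀ i,
      ContDiffAt ℝ ∞ (fun y => (finBasis ℝ V).repr (w y) i) y := fun w hw i =>
    (LinearMap.toContinuousLinearMap ((finBasis ℝ V).coord i)).contDiff.contDiffAt.comp y hw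
  have h : (fun y => f y ![u y, v y]) = fun y => ∑ i, ∑ j, (finBasis ℝ V).repr (u y) i •
      (finBasis ℝ V).repr (v y) j • f y ![finBasis ℝ V i, finBasis ℝ V j] :=
    funext fun y => alternating_apply_eq_sum _ _ _
  rw [h]
  refine ContDiffAt.sum fun i _ => ContDiffAt.sum fun j _ => ?_
  exact (hcoord u hu i).smul ((hcoord v hv j).smul (contDiffAt_alternating_iff.1 hf _ _))

theorem contDiffAt_compContinuousLinearMap {Y X : Type*} [NormedAddCommGroup Y] [NormedSpace ℝ Y]
    [NormedAddCommGroup X] [NormedSpace ℝ X] [FiniteDimensional ℝ X]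
    {f : Y → V [⋀^Fin 2]→L[ℝ] ℂ} {A : Y → X →L[ℝ] V} {y : Y}
    (hf : ContDiffAt ℝ ∞ f y) (hA : ContDiffAt ℝ ∞ A y) :
    ContDiffAt ℝ ∞ (fun y => (f y).compContinuousLinearMap (A y)) y := by
  rw [contDiffAt_alternating_iff]
  intro u v
  refine (contDiffAt_alternating_apply hf (hA.clm_apply contDiffAt_const)
    (hA.clm_apply contDiffAt_const) (u := fun y => A y u) (v := fun y => A y v)).congr_of_eventuallyEq
    (Eventually.of_forall fun y => ?_)
  change f y (A y ∘ ![u, v]) = f y ![A y u, A y v]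
  congr 1
  funext i; fin_cases i <;> rfl

end Alternating

section Pullback

variable {E : Type*} [NormedAddCommGroup E] [NormedSpace ℝ E]
  {M : Type*} [TopologicalSpace M] [ChartedSpace E M]
  {E' : Type*} [NormedAddCommGroup E'] [NormedSpace ℝ E']
  {M' : Type*} [TopologicalSpace M'] [ChartedSpace E' M']
  {E'' : Type*} [NormedAddCommGroup E''] [NormedSpace ℝ E'']
  {M'' : Type*} [TopologicalSpace M''] [ChartedSpace E'' M'']

theorem TwoForm.pullback_apply (f : M → M') (Ω : TwoForm E' M') (x : M)
    (u v : TangentSpace 𝓘(ℝ, E) x) :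
    TwoForm.pullback (E := E) f Ω x ![u, v] =
      Ω (f x) ![mfderiv 𝓘(ℝ, E) 𝓘(ℝ, E') f x u, mfderiv 𝓘(ℝ, E) 𝓘(ℝ, E') f x v] := by
  change Ω (f x) (mfderiv 𝓘(ℝ, E) 𝓘(ℝ, E') f x ∘ ![u, v]) = _
  congr 1
  funext i; fin_cases i <;> rfl

theorem TwoForm.pullback_congr {f g : M → M'} (Ω : TwoForm E' M') {x : M} (h : f =ᶠ[𝓝 x] g) :
    TwoForm.pullback (E := E) f Ω x = TwoForm.pullback (E := E) g Ω x := by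
  have hd : (mfderiv 𝓘(ℝ, E) 𝓘(ℝ, E') f x : E →L[ℝ] E') = mfderiv 𝓘(ℝ, E) 𝓘(ℝ, E') g x :=
    h.mfderiv_eq
  -- Forgetting that the arguments live in a tangent space at y allows the base point to be
  -- rewritten.
  let Ω' : M' → (Fin 2 → E') → ℂ := fun y w => Ω y w
  ext w
  change Ω' (f x) ((mfderiv 𝓘(ℝ, E) 𝓘(ℝ, E') f x : E →L[ℝ] E') ∘ w) =
    Ω' (g x) ((mfderiv 𝓘(ℝ, E) 𝓘(ℝ, E') g x : E →L[ℝ] E') ∘ w)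
  rw [hd, h.self_of_nhds]

theorem TwoForm.pullback_comp {f : M → M'} {g : M' → M''} (Ω : TwoForm E'' M'') {x : M}
    (hg : MDifferentiableAt 𝓘(ℝ, E') 𝓘(ℝ, E'') g (f x))
    (hf : MDifferentiableAt 𝓘(ℝ, E) 𝓘(ℝ, E') f x) :
    TwoForm.pullback (E := E) (g ∘ f) Ω x =
      TwoForm.pullback (E := E) f (TwoForm.pullback (E := E') g Ω) x := by
  unfold TwoForm.pullback
  rw [mfderiv_comp x hg hf]
  rfl

theorem TwoForm.ext_apply {Ω Ω' : TwoForm E M} (h : ∀ x u v, Ω x ![u, v] = Ω' x ![u, v]) :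
    Ω = Ω' :=
  funext fun x => alternating_ext (V := E) (h x)

end Pullback

section SmoothClosed

variable {X : Type*} [NormedAddCommGroup X] [NormedSpace ℝ X]
  {E : Type*} [NormedAddCommGroup E] [NormedSpace ℝ E]
  {M : Type*} [TopologicalSpace M] [ChartedSpace E M] [IsManifold 𝓘(ℝ, E) ∞ M]

/-- The pullback of a `2`-form to a vector space, as a function with values in alternating maps. -/
def TwoForm.pullbackFun (f : X → M) (Ω : TwoForm E M) : X → X [⋀^Fin 2]→L[ℝ] ℂ :=
  TwoForm.pullback (E := X) f Ω

/-- The pullback of a form to a vector space, near a point, through a chart of the target. -/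
theorem TwoForm.pullbackFun_eventuallyEq (Ω : TwoForm E M) {f : X → M} {x : X}
    (hf : ContMDiffAt 𝓘(ℝ, X) 𝓘(ℝ, E) 1 f x) :
    Ω.pullbackFun f =ᶠ[𝓝 x] fun y =>
      (Ω.inChart (f x) (chartAt E (f x) (f y))).compContinuousLinearMap
        (fderiv ℝ (fun y => chartAt E (f x) (f y)) y) := by
  set φ := chartAt E (f x)
  have hφ := mdifferentiable_chart (I := 𝓘(ℝ, E)) (f x)
  have h1 : ∀ᶠ y in 𝓝 x, f y ∈ φ.source :=
    hf.continuousAt (φ.open_source.mem_nhds (mem_chart_source E (f x)))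
  have h2 : ∀ᶠ y in 𝓝 x, ContMDiffAt 𝓘(ℝ, X) 𝓘(ℝ, E) 1 f y :=
    (contMDiffAt_iff_contMDiffAt_nhds (by simp)).1 hf
  filter_upwards [h1.eventually_nhds, h2] with y hy hfy
  have e1 : f =ᶠ[𝓝 y] φ.symm ∘ (fun y => φ (f y)) := by
    filter_upwards [hy] with w hw using (φ.left_inv hw).symm
  have hy' : f y ∈ φ.source := hy.self_of_nhds
  have hd : MDifferentiableAt 𝓘(ℝ, X) 𝓘(ℝ, E) (fun y => φ (f y)) y :=
    (hφ.mdifferentiableAt hy').comp y (hfy.mdifferentiableAt (by simp))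
  have e2 := TwoForm.pullback_comp (g := φ.symm) (f := fun y => φ (f y)) Ω (hφ.mdifferentiableAt_symm (φ.map_source hy')) hd
  rw [← mfderiv_eq_fderiv]
  exact (TwoForm.pullback_congr Ω e1).trans e2

/-- Closedness is defined in preferred charts only. Since the exterior derivative commutes with
pullback, passing through the chart at `f x` extends it to every smooth map from a vector space. -/
theorem TwoForm.extDeriv_pullbackFun {Ω : TwoForm E M} (hΩ : Ω.IsSmooth) (hΩc : Ω.IsClosed)
    {f : X → M} {x : X} (hf : ContMDiffAt 𝓘(ℝ, X) 𝓘(ℝ, E) ∞ f x) :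
    extDeriv (Ω.pullbackFun f) x = 0 := by
  have h1 : ContDiffAt ℝ ∞ (fun y => chartAt E (f x) (f y)) x := by
    rw [← contMDiffAt_iff_contDiffAt]
    exact ((contMDiffOn_chart (I := 𝓘(ℝ, E))).contMDiffAt
      ((chartAt E (f x)).open_source.mem_nhds (mem_chart_source E (f x)))).comp x hf
  rw [(Ω.pullbackFun_eventuallyEq (hf.of_le (by simp))).extDeriv_eq]
  rw [extDeriv_pullback (r := ∞) ?_ h1
    (by rw [minSmoothness_of_isRCLikeNormedField]; exact ENat.LEInfty.out)]
  · rw [hΩc (f x) _ (mem_chart_target E (f x))]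
    rfl
  · exact ((hΩ (f x)).contDiffAt ((chartAt E (f x)).open_target.mem_nhds
      (mem_chart_target E (f x)))).differentiableAt (by simp)

variable [FiniteDimensional ℝ X] [FiniteDimensional ℝ E]

theorem TwoForm.contDiffAt_pullbackFun {Ω : TwoForm E M} (hΩ : Ω.IsSmooth) {f : X → M} {x : X}
    (hf : ContMDiffAt 𝓘(ℝ, X) 𝓘(ℝ, E) ∞ f x) : ContDiffAt ℝ ∞ (Ω.pullbackFun f) x := by
  have h1 : ContDiffAt ℝ ∞ (fun y => chartAt E (f x) (f y)) x := by
    rw [← contMDiffAt_iff_contDiffAt]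
    exact ((contMDiffOn_chart (I := 𝓘(ℝ, E))).contMDiffAt
      ((chartAt E (f x)).open_source.mem_nhds (mem_chart_source E (f x)))).comp x hf
  refine ContDiffAt.congr_of_eventuallyEq ?_ (Ω.pullbackFun_eventuallyEq (hf.of_le (by simp)))
  refine contDiffAt_compContinuousLinearMap ?_ (h1.fderiv_right (by simp))
  refine ContDiffAt.comp x ?_ h1
  exact (hΩ (f x)).contDiffAt ((chartAt E (f x)).open_target.mem_nhds (mem_chart_target E (f x)))

end SmoothClosed

end BraneReduction
end

noncomputable section
namespace BraneReduction

open Module Set Filter Topology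

/-! ### Smoothness and closedness of a descended form -/

section Descent

variable {N K F E Z Q M : Type*} [NormedAddCommGroup N] [NormedSpace ℝ N]
  [NormedAddCommGroup K] [NormedSpace ℝ K] [NormedAddCommGroup F] [NormedSpace ℝ F]
  [NormedAddCommGroup E] [NormedSpace ℝ E]
  [TopologicalSpace Z] [ChartedSpace F Z] [TopologicalSpace Q] [ChartedSpace N Q]
  [IsManifold 𝓘(ℝ, N) ∞ Q] [TopologicalSpace M] [ChartedSpace E M]
  {q : Z → Q} {ι : Z → M} {Ω : TwoForm E M} {Ω' : TwoForm N Q}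

/-- If `q^* Ω' = ι^* Ω` for a submersion `q`, then, in charts, `Ω'` is locally a pullback of `Ω`. -/
theorem TwoForm.inChart_eventuallyEq_pullbackFun
    (hq : Manifold.IsSubmersionOfComplement K 𝓘(ℝ, F) 𝓘(ℝ, N) ∞ q)
    (hqs : Function.Surjective q) (hι : ContMDiff 𝓘(ℝ, F) 𝓘(ℝ, E) ∞ ι)
    (h : TwoForm.pullback (E := F) q Ω' = TwoForm.pullback (E := F) ι Ω)
    {x₀ : Q} {y : N} (hy : y ∈ (chartAt N x₀).target) :
    ∃ f : N → M, ContMDiffAt 𝓘(ℝ, N) 𝓘(ℝ, E) ∞ f y ∧ Ω'.inChart x₀ =ᶠ[𝓝 y] Ω.pullbackFun f := by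
  set φ := chartAt N x₀
  obtain ⟨z, hz⟩ := hqs (φ.symm y)
  obtain ⟨U, σ, hU, hzU, hσ, -, hqσ⟩ := exists_local_section (hq z)
  rw [hz] at hzU
  have hφ : ContMDiffOn 𝓘(ℝ, N) 𝓘(ℝ, N) ∞ φ.symm φ.target := contMDiffOn_chart_symm
  have hW : IsOpen (φ.target ∩ φ.symm ⁻¹' U) :=
    φ.symm.continuousOn.isOpen_inter_preimage φ.open_target hU
  have hs : ContMDiffOn 𝓘(ℝ, N) 𝓘(ℝ, F) ∞ (σ ∘ φ.symm) (φ.target ∩ φ.symm ⁻¹' U) :=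
    hσ.comp (hφ.mono inter_subset_left) inter_subset_right
  have hWy := hW.mem_nhds ⟨hy, hzU⟩
  -- Since q ∘ σ is the identity, pulling Ω' back by φ.symm is the same as pulling q^* Ω' = ι^* Ω
  -- back by σ ∘ φ.symm.
  refine ⟨ι ∘ (σ ∘ φ.symm), hι.contMDiffAt.comp y (hs.contMDiffAt hWy), ?_⟩
  filter_upwards [hW.mem_nhds ⟨hy, hzU⟩] with w hw
  have hsw : MDifferentiableAt 𝓘(ℝ, N) 𝓘(ℝ, F) (σ ∘ φ.symm) w :=
    (hs.contMDiffAt (hW.mem_nhds hw)).mdifferentiableAt (by simp)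
  have e1 := TwoForm.pullback_comp Ω (hι.mdifferentiable (by simp) ((σ ∘ φ.symm) w)) hsw
  have e2 := TwoForm.pullback_comp Ω' (hq.contMDiff.mdifferentiable (by simp) ((σ ∘ φ.symm) w)) hsw
  have e3 : q ∘ (σ ∘ φ.symm) =ᶠ[𝓝 w] φ.symm := by
    filter_upwards [hW.mem_nhds hw] with v hv using hqσ _ hv.2
  rw [← h] at e1
  exact (TwoForm.pullback_congr Ω' e3).symm.trans (e2.trans e1.symm)

variable [IsManifold 𝓘(ℝ, E) ∞ M]

/-- A form whose pullback by a surjective submersion is the pullback of a closed form is closed. -/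
theorem TwoForm.isClosed_of_pullback_eq
    (hq : Manifold.IsSubmersionOfComplement K 𝓘(ℝ, F) 𝓘(ℝ, N) ∞ q)
    (hqs : Function.Surjective q) (hι : ContMDiff 𝓘(ℝ, F) 𝓘(ℝ, E) ∞ ι)
    (h : TwoForm.pullback (E := F) q Ω' = TwoForm.pullback (E := F) ι Ω)
    (hΩ : Ω.IsSmooth) (hΩc : Ω.IsClosed) : Ω'.IsClosed := by
  intro x₀ y hy
  obtain ⟨f, hf, hfe⟩ := TwoForm.inChart_eventuallyEq_pullbackFun hq hqs hι h hy
  rw [hfe.extDeriv_eq]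
  exact TwoForm.extDeriv_pullbackFun hΩ hΩc hf

/-- A form whose pullback by a surjective submersion is the pullback of a smooth form is smooth. -/
theorem TwoForm.isSmooth_of_pullback_eq [FiniteDimensional ℝ N] [FiniteDimensional ℝ E]
    (hq : Manifold.IsSubmersionOfComplement K 𝓘(ℝ, F) 𝓘(ℝ, N) ∞ q)
    (hqs : Function.Surjective q) (hι : ContMDiff 𝓘(ℝ, F) 𝓘(ℝ, E) ∞ ι)
    (h : TwoForm.pullback (E := F) q Ω' = TwoForm.pullback (E := F) ι Ω)
    (hΩ : Ω.IsSmooth) : Ω'.IsSmooth := by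
  intro x₀ y hy
  obtain ⟨f, hf, hfe⟩ := TwoForm.inChart_eventuallyEq_pullbackFun hq hqs hι h hy
  exact ((TwoForm.contDiffAt_pullbackFun hΩ hf).congr_of_eventuallyEq hfe).contDiffWithinAt

end Descent

end BraneReduction
end

noncomputable section
namespace BraneReduction

open Module Set Filter Topology

/-! ### Pointwise existence and uniqueness of the descended form -/

section DescentExistence

variable {N F Z Q : Type*} [NormedAddCommGroup N] [NormedSpace ℝ N]
  [NormedAddCommGroup F] [NormedSpace ℝ F]
  [TopologicalSpace Z] [ChartedSpace F Z] [TopologicalSpace Q] [ChartedSpace N Q] {q : Z → Q}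

/-- Pullback by a surjective map with surjective derivatives is injective on forms. -/
theorem TwoForm.pullback_injective (hqs : Function.Surjective q)
    (hdq : ∀ z, Function.Surjective (mfderiv 𝓘(ℝ, F) 𝓘(ℝ, N) q z)) :
    Function.Injective (TwoForm.pullback (E := F) (E' := N) q) := by
  intro Ω Ω' h
  apply TwoForm.ext_apply
  intro x u v
  obtain ⟨z, rfl⟩ := hqs x
  obtain ⟨u, rfl⟩ := hdq z u
  obtain ⟨v, rfl⟩ := hdq z v
  rw [← TwoForm.pullback_apply, ← TwoForm.pullback_apply, h]

/-- A form which is invariant under maps permuting the fibres of `q` transitively and vanishes on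
the vectors tangent to the fibres is the pullback of a form by `q`. -/
theorem TwoForm.exists_pullback_eq [FiniteDimensional ℝ N] (hqs : Function.Surjective q)
    (hq : MDifferentiable 𝓘(ℝ, F) 𝓘(ℝ, N) q)
    (hdq : ∀ z, Function.Surjective (mfderiv 𝓘(ℝ, F) 𝓘(ℝ, N) q z)) {Θ : TwoForm F Z}
    (hker : ∀ z u, mfderiv 𝓘(ℝ, F) 𝓘(ℝ, N) q z u = 0 → ∀ v, Θ z ![u, v] = 0)
    (hsymm : ∀ z z', q z = q z' → ∃ h : Z → Z, MDifferentiable 𝓘(ℝ, F) 𝓘(ℝ, F) h ∧ h z = z' ∧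
      (∀ w, q (h w) = q w) ∧ TwoForm.pullback h Θ = Θ) :
    ∃ Ω : TwoForm N Q, TwoForm.pullback (E := F) q Ω = Θ := by
  -- Arbitrary right inverses of dq and arbitrary preimages suffice: no smoothness is claimed here,
  -- and it is recovered later from `TwoForm.isSmooth_of_pullback_eq`.
  have hR : ∀ z, ∃ R : N →L[ℝ] F, ∀ n : N, mfderiv 𝓘(ℝ, F) 𝓘(ℝ, N) q z (R n) = n := by
    intro z
    obtain ⟨R, hR⟩ := (mfderiv 𝓘(ℝ, F) 𝓘(ℝ, N) q z).toLinearMap.exists_rightInverse_of_surjective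
      (LinearMap.range_eq_top.2 (hdq z))
    let R' : N →ₗ[ℝ] F := R
    exact ⟨R'.toContinuousLinearMap, fun n => LinearMap.congr_fun hR n⟩
  choose R hR using hR
  let dq : Z → F →L[ℝ] N := fun z => mfderiv 𝓘(ℝ, F) 𝓘(ℝ, N) q z
  let β : Z → F → F → ℂ := fun z u v => Θ z ![u, v]
  have hR' : ∀ z n, dq z (R z n) = n := hR
  have hβ : ∀ z u v, β z u v = -β z v u := fun z => Θ.bilin_swap z
  have hzero : ∀ z (u u' v : F), dq z u = dq z u' → β z u v = β z u' v := by
    intro z u u' v huu'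
    have h1 : dq z (u - u') = 0 := by rw [map_sub, huu', sub_self]
    have h2 : β z (u - u') v = 0 := hker z _ h1 v
    have h3 : β z (u - u') v = β z u v - β z u' v := (Θ.bilin z).map_sub₂ u u' v
    rw [h3] at h2
    exact sub_eq_zero.1 h2
  let s := Function.surjInv hqs
  let Ω : TwoForm N Q := fun x =>
    (ContinuousAlternatingMap.compContinuousLinearMap (M := F) (Θ (s x)) (R (s x)) :
      N [⋀^Fin 2]→L[ℝ] ℂ)
  have hΩ : ∀ x (u v : N), Ω x ![u, v] = β (s x) (R (s x) u) (R (s x) v) := by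
    intro x u v
    change Θ (s x) (R (s x) ∘ ![u, v]) = Θ (s x) ![R (s x) u, R (s x) v]
    congr 1
    funext i; fin_cases i <;> rfl
  refine ⟨Ω, TwoForm.ext_apply fun z u v => ?_⟩
  rw [TwoForm.pullback_apply]
  refine (hΩ _ _ _).trans ?_
  obtain ⟨h, hh, hhz, hqh, hhΘ⟩ := hsymm z (s (q z)) (Function.surjInv_eq hqs (q z)).symm
  let dh : F →L[ℝ] F := mfderiv 𝓘(ℝ, F) 𝓘(ℝ, F) h z
  have e1 : ∀ w : F, dq z w = dq (h z) (dh w) := by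
    intro w
    have e := mfderiv_comp_apply z (hq (h z)) (hh z) w
    have e' : q ∘ h = q := funext hqh
    rw [e'] at e
    exact e
  have e2 : ∀ w w' : F, β (h z) (dh w) (dh w') = β z w w' := by
    intro w w'
    have e := TwoForm.pullback_apply h Θ z w w'
    rw [hhΘ] at e
    exact e.symm
  have key : ∀ z', h z = z' → ∀ u v : F, β z' (R z' (dq z u)) (R z' (dq z v)) = β z u v := by
    rintro _ rfl u v
    -- R (dq u) and dh u have the same image under dq, so they differ by a vertical vector, which Θ
    -- kills. Skew-symmetry handles the second slot in the same way.
    rw [← e2, hzero (h z) _ (dh u) _ ((hR' (h z) _).trans (e1 u)), hβ,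
      hzero (h z) _ (dh v) _ ((hR' (h z) _).trans (e1 v)), ← hβ]
  exact key _ hhz u v

end DescentExistence

/-! ### Linear algebra of the radical on a coisotropic subspace -/

section Coisotropic

variable {V : Type*} [AddCommGroup V] [Module ℝ V] [FiniteDimensional ℝ V]

/-- Let `B` be a skew complex-valued form for which multiplication by `I` is induced by vectors.
If `S` is the `B`-orthogonal complement of a subspace `A` and `A ≤ S`, then the dimension
of the radical of the restriction of `B` to `S` is determined by that of `S`. -/
theorem finrank_radical_add_finrank (B : V →ₗ[ℝ] V →ₗ[ℝ] ℂ) (hB : ∀ u v, B u v = -B v u)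
    (hJ : ∀ u, ∃ w, ∀ v, B w v = Complex.I * B u v) (A S P : Submodule ℝ V) (hAS : A ≤ S)
    (hS : ∀ u, u ∈ S ↔ ∀ a ∈ A, B a u = 0) (hP : ∀ u, u ∈ P ↔ u ∈ S ∧ ∀ v ∈ S, B u v = 0) :
    finrank ℝ P + finrank ℝ S = finrank ℝ V + finrank ℝ (LinearMap.ker B) := by
  let b : LinearMap.BilinForm ℝ V := B.compr₂ Complex.reLm
  have hb : ∀ u v, b u v = (B u v).re := fun u v => rfl
  have hrefl : b.IsRefl := by
    intro u v h
    rw [hb] at h ⊢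
    rw [hB, Complex.neg_re, h, neg_zero]
  -- On a subspace stable under multiplication by I, replacing n by its I-multiple turns the real
  -- part into minus the imaginary part, so orthogonality for Re B already implies orthogonality for
  -- B.
  have hzero : ∀ (T : Submodule ℝ V), (∀ u ∈ T, ∃ w ∈ T, ∀ v, B w v = Complex.I * B u v) →
      ∀ m, m ∈ b.orthogonal T ↔ ∀ n ∈ T, B n m = 0 := by
    intro T hT m
    rw [LinearMap.BilinForm.mem_orthogonal_iff]
    refine ⟨fun h n hn => ?_, fun h n hn => ?_⟩
    · obtain ⟨w, hw, hwn⟩ := hT n hn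
      have h1 : (B n m).re = 0 := h n hn
      have h2 : (B w m).re = 0 := h w hw
      rw [hwn] at h2
      simp at h2
      exact Complex.ext h1 h2
    · change (B n m).re = 0
      rw [h n hn, Complex.zero_re]
  -- S is stable because it is a B-orthogonal complement: B(a, w) = I · B(a, u) = 0.
  have hSJ : ∀ u ∈ S, ∃ w ∈ S, ∀ v, B w v = Complex.I * B u v := by
    intro u hu
    obtain ⟨w, hw⟩ := hJ u
    refine ⟨w, (hS w).2 fun a ha => ?_, hw⟩
    rw [hB, hw, hB u a, (hS u).1 hu a ha, neg_zero, mul_zero, neg_zero]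
  -- A vector orthogonal to S is orthogonal to A ≤ S, hence lies in S; so the whole orthogonal
  -- complement is the radical.
  have h1 : b.orthogonal S = P := by
    ext m
    rw [hzero S hSJ, hP]
    constructor
    · intro h
      exact ⟨(hS m).2 fun a ha => h a (hAS ha), fun v hv => by rw [hB, h v hv, neg_zero]⟩
    · rintro ⟨-, h⟩ n hn
      rw [hB, h n hn, neg_zero]
  have h2 : S ⊓ b.orthogonal ⊤ = LinearMap.ker B := by
    ext m
    rw [Submodule.mem_inf, hzero ⊤ (fun u _ => (hJ u).imp fun w hw => ⟨trivial, hw⟩),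
      LinearMap.mem_ker]
    constructor
    · rintro ⟨-, h⟩
      ext n
      rw [hB, h n trivial, neg_zero, LinearMap.zero_apply]
    · intro h
      have h' : ∀ n, B n m = 0 := fun n => by rw [hB, h, LinearMap.zero_apply, neg_zero]
      exact ⟨(hS m).2 fun a _ => h' a, fun n _ => h' n⟩
  -- For a reflexive real form, dim S + dim S^⊥ = dim V + dim (S ∩ V^⊥). By `h2` the last
  -- intersection is all of ker B.
  have := LinearMap.BilinForm.finrank_add_finrank_orthogonal hrefl S
  rw [h1, h2] at this
  omega

end Coisotropic

end BraneReduction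
end

noncomputable section
namespace BraneReduction

open Module Set Filter Topology

/-! ### Vector fields in charts -/

section VectorFields

variable {E : Type*} [NormedAddCommGroup E] [NormedSpace ℝ E]
  {M : Type*} [TopologicalSpace M] [ChartedSpace E M] [IsManifold 𝓘(ℝ, E) ∞ M]

omit [IsManifold 𝓘(ℝ, E) ∞ M] in
theorem tangentBundle_mk_eq {x y : M} (h : x = y) (v : E) :
    (⟨x, (v : TangentSpace 𝓘(ℝ, E) x)⟩ : TangentBundle 𝓘(ℝ, E) M) =
      ⟨y, (v : TangentSpace 𝓘(ℝ, E) y)⟩ := by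
  subst h; rfl

/-- The vector field which is given by `w` in the chart at `x₀`. -/
def chartVectorField (x₀ : M) (w : E → E) (x : M) : TangentSpace 𝓘(ℝ, E) x :=
  (mfderiv 𝓘(ℝ, E) 𝓘(ℝ, E) (chartAt E x₀).symm (chartAt E x₀ x) (w (chartAt E x₀ x)) : E)

/-- The field is the composite of the chart, the section y ↦ (y, w y) and the tangent map of the
inverse chart, all of them smooth. -/
theorem isSmoothVectorFieldOn_chartVectorField (x₀ : M) {w : E → E} {W : Set E}
    (hW : W ⊆ (chartAt E x₀).target) (hw : ContDiffOn ℝ ∞ w W) :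
    IsSmoothVectorFieldOn (chartVectorField x₀ w)
      ((chartAt E x₀).source ∩ chartAt E x₀ ⁻¹' W) := by
  set φ := chartAt E x₀
  have h1 : ContMDiffOn 𝓘(ℝ, E).tangent 𝓘(ℝ, E).tangent ∞
      (tangentMapWithin 𝓘(ℝ, E) 𝓘(ℝ, E) φ.symm φ.target)
      (Bundle.TotalSpace.proj ⁻¹' φ.target) :=
    ContMDiffOn.contMDiffOn_tangentMapWithin (n := ∞) (contMDiffOn_chart_symm (x := x₀)) (by simp)
      φ.open_target.uniqueMDiffOn
  have h2 : ContMDiffOn 𝓘(ℝ, E) 𝓘(ℝ, E).tangent ∞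
      (fun y => (⟨y, w y⟩ : TangentBundle 𝓘(ℝ, E) E)) W :=
    contMDiffOn_vectorSpace_iff_contDiffOn.2 hw
  have h3 : ContMDiffOn 𝓘(ℝ, E) 𝓘(ℝ, E) ∞ φ (φ.source ∩ φ ⁻¹' W) :=
    (contMDiffOn_chart (x := x₀)).mono inter_subset_left
  refine (h1.comp (h2.comp h3 inter_subset_right) ?_).congr ?_
  · exact fun x hx => hW hx.2
  · rintro x ⟨hx, hx'⟩
    have e1 : mfderivWithin 𝓘(ℝ, E) 𝓘(ℝ, E) φ.symm φ.target (φ x) =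
        mfderiv 𝓘(ℝ, E) 𝓘(ℝ, E) φ.symm (φ x) :=
      mfderivWithin_of_isOpen φ.open_target (hW hx')
    simp only [Function.comp_apply, tangentMapWithin, e1]
    exact (tangentBundle_mk_eq (φ.left_inv hx) _).symm

theorem exists_chart_coordinate (x₀ : M) {X : ∀ x : M, TangentSpace 𝓘(ℝ, E) x} {U : Set M}
    (hX : IsSmoothVectorFieldOn X U) :
    ∃ w : E → E, ContDiffOn ℝ ∞ w ((chartAt E x₀).target ∩ (chartAt E x₀).symm ⁻¹' U) ∧
      ∀ x ∈ (chartAt E x₀).source, chartVectorField x₀ w x = X x := by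
  set φ := chartAt E x₀
  have hφ := mdifferentiable_chart (I := 𝓘(ℝ, E)) x₀
  have h1 : ContMDiffOn 𝓘(ℝ, E).tangent 𝓘(ℝ, E).tangent ∞
      (tangentMapWithin 𝓘(ℝ, E) 𝓘(ℝ, E) φ φ.source)
      (Bundle.TotalSpace.proj ⁻¹' φ.source) :=
    ContMDiffOn.contMDiffOn_tangentMapWithin (n := ∞) (contMDiffOn_chart (x := x₀)) (by simp)
      φ.open_source.uniqueMDiffOn
  have h3 : ContMDiffOn 𝓘(ℝ, E) 𝓘(ℝ, E) ∞ φ.symm (φ.target ∩ φ.symm ⁻¹' U) :=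
    (contMDiffOn_chart_symm (x := x₀)).mono inter_subset_left
  have h4 := h1.comp (ContMDiffOn.comp hX h3 inter_subset_right)
    (fun y hy => φ.map_target hy.1)
  refine ⟨fun y => mfderiv 𝓘(ℝ, E) 𝓘(ℝ, E) φ (φ.symm y) (X (φ.symm y)), ?_, ?_⟩
  · refine ContMDiffOn.contDiffOn (((contMDiff_snd_tangentBundle_modelSpace E 𝓘(ℝ, E)).comp_contMDiffOn h4).congr ?_)
    intro y hy
    have e1 : mfderivWithin 𝓘(ℝ, E) 𝓘(ℝ, E) φ φ.source (φ.symm y) =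
        mfderiv 𝓘(ℝ, E) 𝓘(ℝ, E) φ (φ.symm y) :=
      mfderivWithin_of_isOpen φ.open_source (φ.map_target hy.1)
    exact (congrArg (fun f : E →L[ℝ] E => f (X (φ.symm y))) e1).symm
  · intro x hx
    have key : ∀ x', x' = x → (mfderiv 𝓘(ℝ, E) 𝓘(ℝ, E) φ.symm (φ x)
        (mfderiv 𝓘(ℝ, E) 𝓘(ℝ, E) φ x' (X x')) : E) = X x := by
      intro x' hx'
      subst hx'
      exact congrArg (fun f : E →L[ℝ] E => f (X x')) (hφ.symm_comp_deriv hx)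
    exact key _ (φ.left_inv hx)

end VectorFields

end BraneReduction
end

noncomputable section
namespace BraneReduction

open Module Set Filter Topology

/-! ### Constant rank gives the radical bundle and the complex structure -/

section ConstantRank

variable {E : Type*} [NormedAddCommGroup E] [NormedSpace ℝ E] [FiniteDimensional ℝ E]
  {M : Type*} [TopologicalSpace M] [ChartedSpace E M] [IsManifold 𝓘(ℝ, E) ∞ M]

/-- The map `V → V^*` induced by an alternating form, in coordinates on the dual space. -/
def alternatingToDual (B : E [⋀^Fin 2]→L[ℝ] ℂ) : E →L[ℝ] (Fin (finrank ℝ E) → ℂ) :=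
  LinearMap.toContinuousLinearMap
    (LinearMap.pi fun j => (alternatingBilin B).flip (finBasis ℝ E j))

/-- Two values of c matter: with u = 0 and c = 0 this describes the radical, and c = I gives the
equation for a representative of the complex structure applied to u. -/
theorem alternatingToDual_eq_iff (B : E [⋀^Fin 2]→L[ℝ] ℂ) (c : ℂ) (u w : E) :
    alternatingToDual B w = c • alternatingToDual B u ↔ ∀ v, B ![w, v] = c * B ![u, v] := by
  constructor
  · intro h
    have h1 : alternatingBilin B w = (LinearMap.mulLeft ℝ c) ∘ₗ alternatingBilin B u :=
      (finBasis ℝ E).ext fun j => congrFun h j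
    exact fun v => LinearMap.congr_fun h1 v
  · intro h
    funext j
    exact h _

omit [IsManifold 𝓘(ℝ, E) ∞ M] in
theorem contDiffOn_alternatingToDual {Ω : TwoForm E M} (hΩ : Ω.IsSmooth) (x₀ : M) :
    ContDiffOn ℝ ∞ (fun y => alternatingToDual (Ω.inChart x₀ y)) (chartAt E x₀).target := by
  rw [contDiffOn_clm_apply]
  intro u
  rw [contDiffOn_pi]
  intro j y hy
  have h := (hΩ x₀).contDiffAt ((chartAt E x₀).open_target.mem_nhds hy)
  exact (contDiffAt_alternating_iff.1 h _ _).contDiffWithinAt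

/-- The derivative at `φ x` of the inverse of the chart `φ` at `x₀`. -/
def chartSymmDeriv (x₀ x : M) : E →L[ℝ] E :=
  mfderiv 𝓘(ℝ, E) 𝓘(ℝ, E) (chartAt E x₀).symm (chartAt E x₀ x)

omit [FiniteDimensional ℝ E] in
theorem chartSymmDeriv_bijective {x₀ x : M} (hx : x ∈ (chartAt E x₀).source) :
    Function.Bijective (chartSymmDeriv (E := E) x₀ x) :=
  (mdifferentiable_chart (I := 𝓘(ℝ, E)) x₀).symm.mfderiv_bijective
    ((chartAt E x₀).map_source hx)

omit [FiniteDimensional ℝ E] [IsManifold 𝓘(ℝ, E) ∞ M] in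
theorem TwoForm.inChart_chart_apply (Ω : TwoForm E M) {x₀ x : M}
    (hx : x ∈ (chartAt E x₀).source) (u v : E) :
    Ω.inChart x₀ (chartAt E x₀ x) ![u, v] =
      Ω x ![chartSymmDeriv (E := E) x₀ x u, chartSymmDeriv (E := E) x₀ x v] := by
  have key : ∀ x', x' = x → ∀ u v : E, Ω x' ![u, v] = Ω x ![u, v] := by
    rintro _ rfl u v; rfl
  exact (TwoForm.pullback_apply _ Ω _ u v).trans (key _ ((chartAt E x₀).left_inv hx) _ _)

theorem TwoForm.alternatingToDual_inChart_eq_iff (Ω : TwoForm E M) {x₀ x : M}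
    (hx : x ∈ (chartAt E x₀).source) (c : ℂ) (u w : E) :
    alternatingToDual (Ω.inChart x₀ (chartAt E x₀ x)) w =
        c • alternatingToDual (Ω.inChart x₀ (chartAt E x₀ x)) u ↔
      ∀ v : E, Ω x ![chartSymmDeriv (E := E) x₀ x w, v] = c * Ω x ![chartSymmDeriv (E := E) x₀ x u, v] := by
  rw [alternatingToDual_eq_iff]
  constructor
  · intro h v
    obtain ⟨v, rfl⟩ := (chartSymmDeriv_bijective hx).2 v
    exact ((Ω.inChart_chart_apply hx w v).symm.trans (h v)).trans
      (congrArg (c * ·) (Ω.inChart_chart_apply hx u v))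
  · intro h v
    exact ((Ω.inChart_chart_apply hx w v).trans (h _)).trans
      (congrArg (c * ·) (Ω.inChart_chart_apply hx u v).symm)

omit [FiniteDimensional ℝ E] [IsManifold 𝓘(ℝ, E) ∞ M] in
theorem TwoForm.mem_perp_iff (Ω : TwoForm E M) (x : M) (u : E) :
    u ∈ Ω.perp x ↔ ∀ v : E, Ω x ![u, v] = 0 :=
  ⟨fun h v => LinearMap.congr_fun h v, fun h => LinearMap.ext h⟩

theorem TwoForm.chartSymmDeriv_mem_perp_iff (Ω : TwoForm E M) {x₀ x : M}
    (hx : x ∈ (chartAt E x₀).source) (u : E) :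
    chartSymmDeriv (E := E) x₀ x u ∈ Ω.perp x ↔
      u ∈ LinearMap.ker (alternatingToDual (Ω.inChart x₀ (chartAt E x₀ x))).toLinearMap := by
  rw [LinearMap.mem_ker]
  have h := Ω.alternatingToDual_inChart_eq_iff hx 0 0 u
  rw [zero_smul] at h
  refine (Ω.mem_perp_iff x _).trans (Iff.trans ?_ h.symm)
  simp only [zero_mul]

theorem TwoForm.map_ker_alternatingToDual (Ω : TwoForm E M) {x₀ x : M}
    (hx : x ∈ (chartAt E x₀).source) :
    (LinearMap.ker (alternatingToDual (Ω.inChart x₀ (chartAt E x₀ x))).toLinearMap).map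
      (chartSymmDeriv (E := E) x₀ x).toLinearMap = Ω.perp x := by
  apply le_antisymm
  · rintro _ ⟨u, hu, rfl⟩
    exact (Ω.chartSymmDeriv_mem_perp_iff hx u).2 hu
  · intro u hu
    obtain ⟨u, rfl⟩ := (chartSymmDeriv_bijective hx).2 u
    exact ⟨u, (Ω.chartSymmDeriv_mem_perp_iff hx u).1 hu, rfl⟩

/-- This turns constant rank of the radical on M into constant rank of a smooth family on an open
set of E, as needed for frames and generalized inverses. -/
theorem TwoForm.finrank_ker_alternatingToDual (Ω : TwoForm E M) {x₀ y : _}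
    (hy : y ∈ (chartAt E x₀).target) :
    finrank ℝ (LinearMap.ker (alternatingToDual (Ω.inChart x₀ y)).toLinearMap) =
      finrank ℝ (Ω.perp ((chartAt E x₀).symm y)) := by
  have hx := (chartAt E x₀).map_target hy
  let S : Submodule ℝ E := Ω.perp ((chartAt E x₀).symm y)
  have h : Submodule.map (_ : E →ₗ[ℝ] E) _ = S := Ω.map_ker_alternatingToDual hx
  rw [(chartAt E x₀).right_inv hy] at h
  change _ = finrank ℝ S
  rw [← h]
  exact (LinearEquiv.finrank_eq (Submodule.equivMapOfInjective _
    (chartSymmDeriv_bijective hx).1 _))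

/-- The radical of a smooth `2`-form of constant rank is a vector subbundle. -/
theorem TwoForm.isVectorSubbundle_perp {Ω : TwoForm E M} (hΩ : Ω.IsSmooth) {k : ℕ}
    (hk : ∀ x, finrank ℝ (Ω.perp x) = k) : IsVectorSubbundle Ω.perp := by
  refine ⟨k, fun x₀ => ?_⟩
  set φ := chartAt E x₀
  obtain ⟨U', hU', hU'o, hxU', s, hs, hsk⟩ := exists_contDiffOn_ker_frame φ.open_target
    (contDiffOn_alternatingToDual hΩ x₀) (k := k)
    (fun y hy => (Ω.finrank_ker_alternatingToDual hy).trans (hk _)) (mem_chart_target E x₀)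
  refine ⟨φ.source ∩ φ ⁻¹' U', φ.isOpen_inter_preimage hU'o, ⟨mem_chart_source E x₀, hxU'⟩,
    fun i => chartVectorField x₀ (s i), fun i => ?_, ?_⟩
  · exact isSmoothVectorFieldOn_chartVectorField x₀ hU' (hs i)
  · rintro x ⟨hx, hx'⟩
    obtain ⟨h1, h2⟩ := hsk _ hx'
    refine ⟨h1.map' (chartSymmDeriv (E := E) x₀ x).toLinearMap
      (LinearMap.ker_eq_bot.2 (chartSymmDeriv_bijective hx).1), ?_⟩
    rw [← Ω.map_ker_alternatingToDual hx, ← h2, Submodule.map_span, ← Set.range_comp]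
    rfl

omit [FiniteDimensional ℝ E] in
theorem IsVectorSubbundle.exists_finrank_eq {D : ∀ x : M, Submodule ℝ (TangentSpace 𝓘(ℝ, E) x)}
    (h : IsVectorSubbundle D) : ∃ k, ∀ x, finrank ℝ (D x) = k := by
  obtain ⟨k, hk⟩ := h
  refine ⟨k, fun x => ?_⟩
  obtain ⟨U, -, hxU, s, -, hs⟩ := hk x
  obtain ⟨h1, h2⟩ := hs x hxU
  rw [← h2, finrank_span_eq_card h1, Fintype.card_fin]

/-- Multiplication by `I` on the values of `d` is induced by an endomorphism. -/
theorem exists_endomorphism_of_injective {W : Type*} [AddCommGroup W] [Module ℝ W]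
    (d : W →ₗ[ℝ] W →ₗ[ℝ] ℂ) (hd : Function.Injective d)
    (hJ : ∀ p, ∃ p', ∀ r, d p' r = Complex.I * d p r) :
    ∃ J : W →ₗ[ℝ] W, ∀ p r, d (J p) r = Complex.I * d p r := by
  -- Injectivity of d makes each p' unique, so the chosen map is automatically linear.
  choose J hJ using hJ
  refine ⟨⟨⟨J, fun p p' => hd ?_⟩, fun c p => hd ?_⟩, hJ⟩
  · ext r
    simp only [hJ, map_add, LinearMap.add_apply, mul_add]
  · ext r
    simp only [hJ, map_smul, LinearMap.smul_apply, RingHom.id_apply, Complex.real_smul]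
    ring

omit [FiniteDimensional ℝ E] [IsManifold 𝓘(ℝ, E) ∞ M] in
theorem TwoForm.descend_injective (Ω : TwoForm E M) (x : M) :
    Function.Injective (Ω.descend x) := by
  rw [← LinearMap.ker_eq_bot, LinearMap.ker_eq_bot']
  intro p hp
  obtain ⟨u, rfl⟩ := (Ω.perp x).mkQ_surjective p
  rw [Submodule.mkQ_apply, Submodule.Quotient.mk_eq_zero]
  exact LinearMap.ext fun v => LinearMap.congr_fun hp ((Ω.perp x).mkQ v)

/-- On a smooth closed form of constant rank, the almost complex structure exists as soon as
multiplication by `I` is pointwise induced by vectors. -/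
theorem TwoForm.isTransverseHolomorphicSymplectic_of_finrank_eq {Ω : TwoForm E M}
    (hΩ : Ω.IsSmooth) (hΩ' : Ω.IsClosed) {k : ℕ} (hk : ∀ x, finrank ℝ (Ω.perp x) = k)
    (hJ : ∀ (x : M) (u : E), ∃ w : E, ∀ v : E, Ω x ![w, v] = Complex.I * Ω x ![u, v]) :
    IsTransverseHolomorphicSymplectic Ω := by
  refine ⟨hΩ, hΩ', Ω.isVectorSubbundle_perp hΩ hk, ?_⟩
  have hI : ∀ x, ∃ J : Ω.Quo x →ₗ[ℝ] Ω.Quo x,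
      ∀ p r, Ω.descend x (J p) r = Complex.I * Ω.descend x p r := by
    intro x
    refine exists_endomorphism_of_injective _ (Ω.descend_injective x) fun p => ?_
    obtain ⟨u, rfl⟩ := (Ω.perp x).mkQ_surjective p
    obtain ⟨w, hw⟩ := hJ x u
    refine ⟨(Ω.perp x).mkQ w, fun r => ?_⟩
    obtain ⟨v, rfl⟩ := (Ω.perp x).mkQ_surjective r
    exact hw v
  choose I hI using hI
  refine ⟨I, ⟨?_, fun x u => Ω.descend_injective x (LinearMap.ext fun v => ?_)⟩, fun x u v => ?_⟩
  · intro U X hU hX x₀ hx₀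
    set φ := chartAt E x₀
    obtain ⟨w, hw, hwX⟩ := exists_chart_coordinate x₀ hX
    -- In the chart, a representative Y of I X must solve T Y = i T X, where T is
    -- `alternatingToDual`. The right-hand side lies in the range of T by `hJ`, so the generalized
    -- inverse R of T yields the smooth solution Y = R (i T X).
    obtain ⟨U', hU', hU'o, hxU', R, hR, hTRT⟩ := exists_contDiffOn_generalizedInverse
      φ.open_target (contDiffOn_alternatingToDual hΩ x₀) (k := k)
      (fun y hy => (Ω.finrank_ker_alternatingToDual hy).trans (hk _)) (mem_chart_target E x₀)
    have hsub : U' ∩ (φ.target ∩ φ.symm ⁻¹' U) ⊆ φ.target := fun y hy => hU' hy.1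
    refine ⟨φ.source ∩ φ ⁻¹' (U' ∩ (φ.target ∩ φ.symm ⁻¹' U)),
      φ.isOpen_inter_preimage (hU'o.inter (φ.isOpen_inter_preimage_symm hU)),
      ⟨mem_chart_source E x₀, hxU', mem_chart_target E x₀, ?_⟩, ?_,
      chartVectorField x₀
        fun y => R y (Complex.I • alternatingToDual (Ω.inChart x₀ y) (w y)), ?_, ?_⟩
    · rw [mem_preimage, φ.left_inv (mem_chart_source E x₀)]
      exact hx₀
    · rintro x ⟨hx, -, -, hx'⟩
      rwa [mem_preimage, φ.left_inv hx] at hx'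
    · apply isSmoothVectorFieldOn_chartVectorField x₀ hsub
      refine (hR.mono inter_subset_left).clm_apply (ContDiffOn.const_smul _ ?_)
      exact ((contDiffOn_alternatingToDual hΩ x₀).mono hsub).clm_apply
        (hw.mono inter_subset_right)
    · rintro x ⟨hx, hx', -⟩
      apply Ω.descend_injective x
      ext v
      refine Eq.trans ?_ (hI x ((Ω.perp x).mkQ (X x)) ((Ω.perp x).mkQ v)).symm
      rw [← hwX x hx]
      obtain ⟨w', hw'⟩ := hJ x (chartSymmDeriv (E := E) x₀ x (w (φ x)))
      obtain ⟨w', rfl⟩ := (chartSymmDeriv_bijective hx).2 w'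
      have h1 := (Ω.alternatingToDual_inChart_eq_iff hx _ _ _).2 hw'
      have h2 := hTRT _ hx' w'
      rw [h1] at h2
      exact (Ω.alternatingToDual_inChart_eq_iff hx _ _ _).1 h2 v
  · rw [hI, hI, ← mul_assoc, Complex.I_mul_I, map_neg, LinearMap.neg_apply, neg_one_mul]
  · rw [hI]
    simp

-- The compatibility condition applied to u gives the imaginary part of Ω(Iu, v); applied to Iu,
-- together with I² = -1, it gives the real part.
omit [FiniteDimensional ℝ E] in
theorem IsTransverseHolomorphicSymplectic.exists_I_mul {Ω : TwoForm E M}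
    (h : IsTransverseHolomorphicSymplectic Ω) (x : M) (u : E) :
    ∃ w : E, ∀ v : E, Ω x ![w, v] = Complex.I * Ω x ![u, v] := by
  obtain ⟨I, hI, hΩI⟩ := h.almostComplex
  obtain ⟨w, hw⟩ := (Ω.perp x).mkQ_surjective (I x ((Ω.perp x).mkQ u))
  refine ⟨w, fun v => ?_⟩
  have h1 := hΩI x ((Ω.perp x).mkQ u) ((Ω.perp x).mkQ v)
  have h2 := hΩI x (I x ((Ω.perp x).mkQ u)) ((Ω.perp x).mkQ v)
  rw [hI.sq_eq, map_neg, LinearMap.neg_apply] at h2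
  rw [← hw] at h1 h2
  change (Ω x ![u, v]).re = (Ω x ![w, v]).im at h1
  change (Ω x ![w, v]).re = (-(Ω x ![u, v])).im at h2
  apply Complex.ext
  · refine h2.trans ?_
    simp
  · refine h1.symm.trans ?_
    simp

end ConstantRank

end BraneReduction
end

noncomputable section
namespace BraneReduction

open Module Set Filter Topology

/-! ### Local retractions of immersions -/

section Immersion

variable {K F E Z M : Type*} [NormedAddCommGroup K] [NormedSpace ℝ K]
  [NormedAddCommGroup F] [NormedSpace ℝ F] [NormedAddCommGroup E] [NormedSpace ℝ E]
  [TopologicalSpace Z] [ChartedSpace F Z] [TopologicalSpace M] [ChartedSpace E M] {f : Z → M}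

/-- Immersions have local smooth left inverses. -/
theorem exists_local_retraction {z : Z}
    (h : Manifold.IsImmersionAtOfComplement K 𝓘(ℝ, F) 𝓘(ℝ, E) ∞ f z) :
    ∃ r : M → Z, ContMDiffAt 𝓘(ℝ, E) 𝓘(ℝ, F) ∞ r (f z) ∧ ∀ᶠ w in 𝓝 z, r (f w) = w := by
  set φ := h.domChart
  set ψ := h.codChart
  have hφz : z ∈ φ.source := h.mem_domChart_source
  have hψz : f z ∈ ψ.source := h.mem_codChart_source
  let p : E → F := fun v => (h.equiv.symm v).1
  have hp : ContDiff ℝ ∞ p := by fun_prop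
  have hw : ∀ w ∈ φ.source, p (ψ (f w)) = φ w := by
    intro w hw
    have e : ψ (f (φ.symm (φ w))) = h.equiv (φ w, 0) :=
      h.writtenInCharts (by simpa using φ.map_source hw)
    rw [φ.left_inv hw] at e
    simp only [p, e, ContinuousLinearEquiv.symm_apply_apply]
  refine ⟨fun x => φ.symm (p (ψ x)), ?_, ?_⟩
  · have h1 : ContMDiffAt 𝓘(ℝ, E) 𝓘(ℝ, F) ∞ (fun x => p (ψ x)) (f z) :=
      hp.contMDiff.contMDiffAt.comp (f z)
        (contMDiffAt_of_mem_maximalAtlas h.codChart_mem_maximalAtlas hψz)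
    refine ContMDiffAt.comp (f z) ?_ h1
    rw [hw z hφz]
    exact contMDiffAt_symm_of_mem_maximalAtlas h.domChart_mem_maximalAtlas (φ.map_source hφz)
  · filter_upwards [φ.open_source.mem_nhds hφz] with w hw'
    rw [hw w hw', φ.left_inv hw']

/-- The derivative of an immersion is injective. -/
theorem mfderiv_injective_of_isImmersionAt {z : Z}
    (h : Manifold.IsImmersionAtOfComplement K 𝓘(ℝ, F) 𝓘(ℝ, E) ∞ f z) :
    Function.Injective (mfderiv 𝓘(ℝ, F) 𝓘(ℝ, E) f z) := by
  obtain ⟨r, hr, hrf⟩ := exists_local_retraction h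
  have hrf' : (r ∘ f) =ᶠ[𝓝 z] id := hrf
  have key : ∀ v, mfderiv 𝓘(ℝ, E) 𝓘(ℝ, F) r (f z) (mfderiv 𝓘(ℝ, F) 𝓘(ℝ, E) f z v) = v := by
    intro v
    have e := mfderiv_comp_apply z (hr.mdifferentiableAt (by simp))
      (h.contMDiffAt.mdifferentiableAt (by simp)) v
    rw [hrf'.mfderiv_eq, mfderiv_id] at e
    exact e.symm
  exact Function.LeftInverse.injective key

end Immersion

/-! ### Topology of the orbit space -/

section OrbitTopology

variable {G Z Q : Type*} [TopologicalSpace G] [Group G] [TopologicalSpace Z] [MulAction G Z]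
  [ContinuousSMul G Z] [TopologicalSpace Q] {q : Z → Q}

/-- The saturation of an open set is a union of its translates, hence open. -/
theorem isOpenQuotientMap_of_fibers_eq_orbits (hq : IsQuotientMap q)
    (hqG : ∀ z z', q z = q z' ↔ ∃ g : G, g • z = z') : IsOpenQuotientMap q := by
  refine ⟨hq.surjective, hq.continuous, fun U hU => ?_⟩
  rw [← hq.isOpen_preimage]
  have e : q ⁻¹' (q '' U) = ⋃ g : G, (fun z => g • z) ⁻¹' U := by
    ext z
    simp only [mem_preimage, mem_image, mem_iUnion]
    constructor
    · rintro ⟨w, hw, hwz⟩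
      obtain ⟨g, rfl⟩ := (hqG z w).1 hwz.symm
      exact ⟨g, hw⟩
    · rintro ⟨g, hg⟩
      exact ⟨g • z, hg, ((hqG _ _).2 ⟨g, rfl⟩).symm⟩
  rw [e]
  exact isOpen_iUnion fun g => hU.preimage (continuous_const_smul g)

/-- The orbit relation is the projection, along the compact factor G, of the closed set g • z = z'.
It is therefore closed, which is the Hausdorff property for an open quotient. -/
theorem t2Space_of_fibers_eq_orbits [CompactSpace G] [T2Space Z] (hq : IsOpenQuotientMap q)
    (hqG : ∀ z z', q z = q z' ↔ ∃ g : G, g • z = z') : T2Space Q := by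
  rw [t2Space_iff_of_isOpenQuotientMap hq]
  have h : IsClosed {p : G × Z × Z | p.1 • p.2.1 = p.2.2} :=
    isClosed_eq (by fun_prop) (by fun_prop)
  convert isClosedMap_snd_of_compactSpace _ h using 1
  ext ⟨z, z'⟩
  simp [hqG]

end OrbitTopology

/-! ### Vertical vectors of the quotient map -/

section OrbitDerivative

variable {EG : Type*} [NormedAddCommGroup EG] [NormedSpace ℝ EG] [FiniteDimensional ℝ EG]
  {G : Type*} [TopologicalSpace G] [ChartedSpace EG G] [Group G] [LieGroup 𝓘(ℝ, EG) ∞ G]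
  {F : Type*} [NormedAddCommGroup F] [NormedSpace ℝ F] [FiniteDimensional ℝ F]
  {Z : Type*} [TopologicalSpace Z] [ChartedSpace F Z] [IsManifold 𝓘(ℝ, F) ∞ Z]
  [MulAction G Z] [ContMDiffSMul 𝓘(ℝ, EG) 𝓘(ℝ, F) ∞ G Z]

omit [FiniteDimensional ℝ EG] [LieGroup 𝓘(ℝ, EG) ∞ G] [FiniteDimensional ℝ F]
  [IsManifold 𝓘(ℝ, F) ∞ Z] in
/-- The derivative along a map `f` of the infinitesimal action. -/
theorem mfderiv_comp_orbitMap {E M : Type*} [NormedAddCommGroup E] [NormedSpace ℝ E]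
    [TopologicalSpace M] [ChartedSpace E M] {f : Z → M} {z : Z}
    (hf : MDifferentiableAt 𝓘(ℝ, F) 𝓘(ℝ, E) f z) (a : EG) :
    (mfderiv 𝓘(ℝ, EG) 𝓘(ℝ, E) (fun g : G => f (g • z)) 1 a : E) =
      mfderiv 𝓘(ℝ, F) 𝓘(ℝ, E) f z (infinitesimalAction (EG := EG) (G := G) (E := F) a z : F) := by
  let df : Z → F →L[ℝ] E := fun z => mfderiv 𝓘(ℝ, F) 𝓘(ℝ, E) f z
  let da : F := (mfderiv 𝓘(ℝ, EG) 𝓘(ℝ, F) (fun g : G => g • z) 1 a : F)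
  have hz : (1 : G) • z = z := one_smul G z
  have hf' : MDifferentiableAt 𝓘(ℝ, F) 𝓘(ℝ, E) f ((1 : G) • z) := by rwa [hz]
  have e : (mfderiv 𝓘(ℝ, EG) 𝓘(ℝ, E) (f ∘ fun g : G => g • z) 1 a : E) = df ((1 : G) • z) da :=
    mfderiv_comp_apply (1 : G) hf' ((contMDiff_smul_const (EG := EG) (G := G) (E := F)
      z).mdifferentiableAt (by simp)) a
  rw [hz] at e
  exact e

/-- The kernel of the derivative of the quotient map by a free action consists of the tangent
vectors to the orbit. -/
theorem mfderiv_quotient_eq_zero_iff {N Q : Type*} [NormedAddCommGroup N] [NormedSpace ℝ N]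
    [FiniteDimensional ℝ N] [TopologicalSpace Q] [ChartedSpace N Q] {q : Z → Q} {z : Z}
    (hz : ∀ g : G, g • z = z → g = 1) (hqG : ∀ g : G, q (g • z) = q z)
    (hN : finrank ℝ N + finrank ℝ EG = finrank ℝ F)
    (hq : MDifferentiableAt 𝓘(ℝ, F) 𝓘(ℝ, N) q z)
    (hdq : Function.Surjective (mfderiv 𝓘(ℝ, F) 𝓘(ℝ, N) q z)) (u : F) :
    mfderiv 𝓘(ℝ, F) 𝓘(ℝ, N) q z u = 0 ↔
      ∃ a : EG, (infinitesimalAction (EG := EG) (G := G) (E := F) a z : F) = u := by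
  let dq : F →ₗ[ℝ] N := (mfderiv 𝓘(ℝ, F) 𝓘(ℝ, N) q z).toLinearMap
  let χ : EG →ₗ[ℝ] F := (mfderiv 𝓘(ℝ, EG) 𝓘(ℝ, F) (fun g : G => g • z) 1).toLinearMap
  have hχ : Function.Injective χ := mfderiv_orbitMap_injective hz
  have hdq' : Function.Surjective dq := hdq
  have hle : LinearMap.range χ ≤ LinearMap.ker dq := by
    rintro _ ⟨a, rfl⟩
    have e := mfderiv_comp_orbitMap (G := G) hq a
    have hc : ∀ f : G → Q, (f = fun _ => q z) → (mfderiv 𝓘(ℝ, EG) 𝓘(ℝ, N) f 1 a : N) = 0 := by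
      rintro _ rfl
      rw [mfderiv_const]
      rfl
    exact e.symm.trans (hc _ (funext hqG))
  -- Orbit directions are vertical because q is constant on orbits; both spaces have dimension dim F
  -- - dim N.
  have heq : LinearMap.range χ = LinearMap.ker dq := by
    apply Submodule.eq_of_le_of_finrank_eq hle
    have h1 := LinearMap.finrank_range_of_inj hχ
    have h2 := dq.finrank_range_add_finrank_ker
    rw [LinearMap.range_eq_top.2 hdq', finrank_top] at h2
    omega
  change u ∈ LinearMap.ker dq ↔ u ∈ LinearMap.range χ
  rw [heq]

end OrbitDerivative

end BraneReduction
end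

noncomputable section
namespace BraneReduction

open Module Set Filter Topology

/-! ### Ranks of pulled-back forms -/

theorem finrank_comap_of_surjective {V W : Type*} [AddCommGroup V] [Module ℝ V]
    [FiniteDimensional ℝ V] [AddCommGroup W] [Module ℝ W] (f : V →ₗ[ℝ] W)
    (hf : Function.Surjective f) (p : Submodule ℝ W) :
    finrank ℝ (p.comap f) = finrank ℝ p + finrank ℝ (LinearMap.ker f) := by
  have h := (f.domRestrict (p.comap f)).finrank_range_add_finrank_ker
  rw [LinearMap.range_domRestrict, Submodule.map_comap_eq_of_surjective hf,
    LinearMap.ker_domRestrict] at h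
  have hle : LinearMap.ker f ≤ p.comap f := fun x hx => by
    rw [Submodule.mem_comap, LinearMap.mem_ker.1 hx]; exact p.zero_mem
  rw [← h, LinearEquiv.finrank_eq (Submodule.comapSubtypeEquivOfLe hle)]

section Reduction

variable {F E Z C : Type*}
  [NormedAddCommGroup F] [NormedSpace ℝ F] [FiniteDimensional ℝ F]
  [NormedAddCommGroup E] [NormedSpace ℝ E]
  [TopologicalSpace Z] [ChartedSpace F Z] [TopologicalSpace C] [ChartedSpace E C]
  {ι : Z → C} {Ω : TwoForm E C}

omit [FiniteDimensional ℝ F] in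
/-- The rank of the pullback of a form to a submanifold whose tangent space is the orthogonal
complement of a subspace `A` contained in it. -/
theorem finrank_perp_pullback_of_coisotropic [FiniteDimensional ℝ E] {z : Z}
    (hinj : Function.Injective (mfderiv 𝓘(ℝ, F) 𝓘(ℝ, E) ι z))
    (hJ : ∀ u : E, ∃ w : E, ∀ v : E, Ω (ι z) ![w, v] = Complex.I * Ω (ι z) ![u, v])
    (A : Submodule ℝ E)
    (hA : ∀ a ∈ A, ∃ v : F, (mfderiv 𝓘(ℝ, F) 𝓘(ℝ, E) ι z v : E) = a)
    (hS : ∀ u : E, (∃ v : F, (mfderiv 𝓘(ℝ, F) 𝓘(ℝ, E) ι z v : E) = u) ↔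
      ∀ a ∈ A, Ω (ι z) ![a, u] = 0) :
    finrank ℝ ((TwoForm.pullback (E := F) ι Ω).perp z) + finrank ℝ F =
      finrank ℝ E + finrank ℝ (Ω.perp (ι z)) := by
  let B : E →ₗ[ℝ] E →ₗ[ℝ] ℂ := Ω.bilin (ι z)
  let dι : F →ₗ[ℝ] E := (mfderiv 𝓘(ℝ, F) 𝓘(ℝ, E) ι z).toLinearMap
  let T : Submodule ℝ F := (TwoForm.pullback (E := F) ι Ω).perp z
  have hdι : Function.Injective dι := hinj
  have hT : ∀ u : F, u ∈ T ↔ ∀ v : F, B (dι u) (dι v) = 0 := fun u =>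
    (TwoForm.mem_perp_iff _ z u).trans
      (forall_congr' fun v => by
        rw [show TwoForm.pullback (E := F) ι Ω z ![u, v] = B (dι u) (dι v) from
          TwoForm.pullback_apply ι Ω z u v])
  have h := finrank_radical_add_finrank B (fun u v => Ω.bilin_swap (ι z) u v) hJ A
    (LinearMap.range dι) (T.map dι) hA hS (fun u => by
      constructor
      · rintro ⟨u, hu, rfl⟩
        refine ⟨⟨u, rfl⟩, ?_⟩
        rintro _ ⟨v, rfl⟩
        exact (hT u).1 hu v
      · rintro ⟨⟨u, rfl⟩, h⟩
        exact ⟨u, (hT u).2 fun v => h _ ⟨v, rfl⟩, rfl⟩)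
  rw [LinearMap.finrank_range_of_inj hdι,
    ← LinearEquiv.finrank_eq (Submodule.equivMapOfInjective dι hdι T)] at h
  exact h

variable {N Q : Type*} [NormedAddCommGroup N] [NormedSpace ℝ N]
  [TopologicalSpace Q] [ChartedSpace N Q] {q : Z → Q} {Ω' : TwoForm N Q}

/-- The rank of the pullback of a form by a submersion. -/
theorem finrank_perp_pullback_of_surjective {z : Z}
    (hdq : Function.Surjective (mfderiv 𝓘(ℝ, F) 𝓘(ℝ, N) q z)) :
    finrank ℝ ((TwoForm.pullback (E := F) q Ω').perp z) + finrank ℝ N =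
      finrank ℝ (Ω'.perp (q z)) + finrank ℝ F := by
  let B : N →ₗ[ℝ] N →ₗ[ℝ] ℂ := Ω'.bilin (q z)
  let dq : F →ₗ[ℝ] N := (mfderiv 𝓘(ℝ, F) 𝓘(ℝ, N) q z).toLinearMap
  let T : Submodule ℝ F := (TwoForm.pullback (E := F) q Ω').perp z
  let P : Submodule ℝ N := Ω'.perp (q z)
  have hdq' : Function.Surjective dq := hdq
  have hT : T = P.comap dq := by
    ext u
    refine (TwoForm.mem_perp_iff _ z u).trans (Iff.trans ?_ (Ω'.mem_perp_iff _ (dq u)).symm)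
    have e : ∀ v : F, TwoForm.pullback (E := F) q Ω' z ![u, v] = B (dq u) (dq v) :=
      TwoForm.pullback_apply q Ω' z u
    constructor
    · intro h v
      obtain ⟨v, rfl⟩ := hdq' v
      exact (e v).symm.trans (h v)
    · exact fun h v => (e v).trans (h (dq v))
  have h1 := finrank_comap_of_surjective dq hdq' P
  have h2 := dq.finrank_range_add_finrank_ker
  rw [LinearMap.range_eq_top.2 hdq', finrank_top] at h2
  change finrank ℝ T + _ = finrank ℝ P + _
  rw [hT]
  omega

end Reduction

end BraneReduction
end

noncomputable section
namespace BraneReduction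

open Module Set Filter Topology

/-! ### Transfer of the transverse holomorphic symplectic structure to a quotient -/

section Descent

variable {N K F E Z C Q : Type*}
  [NormedAddCommGroup N] [NormedSpace ℝ N] [FiniteDimensional ℝ N]
  [NormedAddCommGroup K] [NormedSpace ℝ K]
  [NormedAddCommGroup F] [NormedSpace ℝ F] [FiniteDimensional ℝ F]
  [NormedAddCommGroup E] [NormedSpace ℝ E] [FiniteDimensional ℝ E]
  [TopologicalSpace Z] [ChartedSpace F Z]
  [TopologicalSpace C] [ChartedSpace E C] [IsManifold 𝓘(ℝ, E) ∞ C]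
  [TopologicalSpace Q] [ChartedSpace N Q] [IsManifold 𝓘(ℝ, N) ∞ Q]
  {ι : Z → C} {Ω : TwoForm E C} {q : Z → Q} {Ω' : TwoForm N Q}

/-- Let `ι : Z → C` be an immersed submanifold whose tangent spaces are the orthogonal complements
of subspaces `A z` contained in them. A form on a quotient of `Z` whose pullback to `Z` is that
of a transverse holomorphic symplectic form is transverse holomorphic symplectic. -/
theorem IsTransverseHolomorphicSymplectic.of_pullback_eq
    (hΩ : IsTransverseHolomorphicSymplectic Ω) (hι : ContMDiff 𝓘(ℝ, F) 𝓘(ℝ, E) ∞ ι)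
    (hinj : ∀ z, Function.Injective (mfderiv 𝓘(ℝ, F) 𝓘(ℝ, E) ι z))
    (hq : Manifold.IsSubmersionOfComplement K 𝓘(ℝ, F) 𝓘(ℝ, N) ∞ q)
    (hqs : Function.Surjective q) (A : Z → Submodule ℝ E)
    (hA : ∀ z, ∀ a ∈ A z, ∃ v : F, (mfderiv 𝓘(ℝ, F) 𝓘(ℝ, E) ι z v : E) = a)
    (hS : ∀ z, ∀ u : E, (∃ v : F, (mfderiv 𝓘(ℝ, F) 𝓘(ℝ, E) ι z v : E) = u) ↔
      ∀ a ∈ A z, Ω (ι z) ![a, u] = 0)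
    (h : TwoForm.pullback (E := F) q Ω' = TwoForm.pullback (E := F) ι Ω) :
    IsTransverseHolomorphicSymplectic Ω' := by
  have hdq : ∀ z, Function.Surjective (mfderiv 𝓘(ℝ, F) 𝓘(ℝ, N) q z) := fun z =>
    mfderiv_surjective_of_isSubmersionAt (hq z)
  obtain ⟨k, hk⟩ := hΩ.subbundle.exists_finrank_eq
  apply TwoForm.isTransverseHolomorphicSymplectic_of_finrank_eq
    (TwoForm.isSmooth_of_pullback_eq hq hqs hι h hΩ.smooth)
    (TwoForm.isClosed_of_pullback_eq hq hqs hι h hΩ.smooth hΩ.closed)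
    -- The rank comes from eliminating the radical on Z between two counts: radical on Z + dim F =
    -- dim E + k, and radical on Z + dim N = radical on Q + dim F.
    (k := finrank ℝ E + k + finrank ℝ N - finrank ℝ F - finrank ℝ F)
  · intro x
    obtain ⟨z, rfl⟩ := hqs x
    have h1 := finrank_perp_pullback_of_surjective (Ω' := Ω') (hdq z)
    have h2 := finrank_perp_pullback_of_coisotropic (hinj z) (hΩ.exists_I_mul (ι z)) (A z) (hA z)
      (hS z)
    rw [h] at h1
    rw [hk] at h2
    omega
  · intro x u
    obtain ⟨z, rfl⟩ := hqs x
    let B : E →ₗ[ℝ] E →ₗ[ℝ] ℂ := Ω.bilin (ι z)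
    let B' : N →ₗ[ℝ] N →ₗ[ℝ] ℂ := Ω'.bilin (q z)
    let dι : F →L[ℝ] E := mfderiv 𝓘(ℝ, F) 𝓘(ℝ, E) ι z
    let dq : F →L[ℝ] N := mfderiv 𝓘(ℝ, F) 𝓘(ℝ, N) q z
    have hdq' : Function.Surjective dq := hdq z
    have hS' : ∀ u : E, (∃ v : F, dι v = u) ↔ ∀ a ∈ A z, B a u = 0 := hS z
    have hB : ∀ u v : E, B u v = -B v u := fun u v => Ω.bilin_swap (ι z) u v
    have e : ∀ u v : F, B' (dq u) (dq v) = B (dι u) (dι v) := fun u v =>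
      (TwoForm.pullback_apply q Ω' z u v).symm.trans
        ((congrArg (fun Θ : TwoForm F Z => Θ z ![u, v]) h).trans (TwoForm.pullback_apply ι Ω z u v))
    obtain ⟨u, rfl⟩ := hdq' u
    obtain ⟨w, hw⟩ := hΩ.exists_I_mul (ι z) (dι u)
    have hw' : ∀ v : E, B w v = Complex.I * B (dι u) v := hw
    -- The I-multiple of a vector tangent to Z is still orthogonal to A z, hence tangent to Z, so it
    -- can be pushed down to Q.
    obtain ⟨w, rfl⟩ := (hS' w).2 fun a ha => by
      rw [hB, hw', hB _ a, (hS' (dι u)).1 ⟨u, rfl⟩ a ha, neg_zero, mul_zero, neg_zero]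
    refine ⟨dq w, fun v => ?_⟩
    obtain ⟨v, rfl⟩ := hdq' v
    change B' (dq w) (dq v) = Complex.I * B' (dq u) (dq v)
    rw [e, e, hw']

end Descent

section Invariance

variable {E F C Z : Type*} [NormedAddCommGroup E] [NormedSpace ℝ E]
  [NormedAddCommGroup F] [NormedSpace ℝ F]
  [TopologicalSpace Z] [ChartedSpace F Z] [TopologicalSpace C] [ChartedSpace E C]

/-- The pullback of an invariant form is invariant. -/
theorem TwoForm.pullback_pullback_of_comp_eq {Ω : TwoForm E C} {ι : Z → C} {a : Z → Z} {b : C → C}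
    (hι : MDifferentiable 𝓘(ℝ, F) 𝓘(ℝ, E) ι) (ha : MDifferentiable 𝓘(ℝ, F) 𝓘(ℝ, F) a)
    (hb : MDifferentiable 𝓘(ℝ, E) 𝓘(ℝ, E) b) (hab : ι ∘ a = b ∘ ι)
    (hΩ : TwoForm.pullback b Ω = Ω) :
    TwoForm.pullback (E := F) a (TwoForm.pullback (E := F) ι Ω) =
      TwoForm.pullback (E := F) ι Ω := by
  funext z
  rw [← TwoForm.pullback_comp Ω (hι _) (ha z), hab, TwoForm.pullback_comp Ω (hb _) (hι z), hΩ]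

end Invariance

/-! ### Reduction by a free action of a compact group -/

section Reduction

variable {EG : Type*} [NormedAddCommGroup EG] [NormedSpace ℝ EG] [FiniteDimensional ℝ EG]
  {G : Type*} [TopologicalSpace G] [ChartedSpace EG G] [Group G] [LieGroup 𝓘(ℝ, EG) ∞ G]
  [CompactSpace G]
  {E : Type*} [NormedAddCommGroup E] [NormedSpace ℝ E] [FiniteDimensional ℝ E]
  {C : Type*} [TopologicalSpace C] [ChartedSpace E C] [IsManifold 𝓘(ℝ, E) ∞ C]
  [MulAction G C] [ContMDiffSMul 𝓘(ℝ, EG) 𝓘(ℝ, E) ∞ G C]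
  {F : Type*} [NormedAddCommGroup F] [NormedSpace ℝ F] [FiniteDimensional ℝ F]
  {Z : Type*} [TopologicalSpace Z] [T2Space Z] [ChartedSpace F Z] [IsManifold 𝓘(ℝ, F) ∞ Z]
  [MulAction G Z] [ContMDiffSMul 𝓘(ℝ, EG) 𝓘(ℝ, F) ∞ G Z]

omit [LieGroup 𝓘(ℝ, EG) ∞ G] [CompactSpace G] [FiniteDimensional ℝ EG] [FiniteDimensional ℝ E]
  [IsManifold 𝓘(ℝ, E) ∞ C] [ContMDiffSMul 𝓘(ℝ, EG) 𝓘(ℝ, E) ∞ G C] [FiniteDimensional ℝ F]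
  [T2Space Z] [IsManifold 𝓘(ℝ, F) ∞ Z] in
theorem mfderiv_infinitesimalAction {ι : Z → C} (hι : MDifferentiable 𝓘(ℝ, F) 𝓘(ℝ, E) ι)
    (hιG : ∀ (g : G) z, ι (g • z) = g • ι z) (a : EG) (z : Z) :
    (mfderiv 𝓘(ℝ, F) 𝓘(ℝ, E) ι z
      (infinitesimalAction (EG := EG) (G := G) (E := F) a z : F) : E) =
      infinitesimalAction (EG := EG) (G := G) (E := E) a (ι z) := by
  refine (mfderiv_comp_orbitMap (hι z) a).symm.trans ?_
  have key : ∀ f : G → C, f = (fun g => g • ι z) → (mfderiv 𝓘(ℝ, EG) 𝓘(ℝ, E) f 1 a : E) =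
      infinitesimalAction (EG := EG) (G := G) (E := E) a (ι z) := by
    rintro _ rfl; rfl
  exact key _ (funext fun g => hιG g z)

/-- Reduction of a transverse holomorphic symplectic form along a free coisotropic submanifold
whose characteristic directions are tangent to the orbits of a compact Lie group. -/
theorem exists_reduction {Ω : TwoForm E C} (hΩ : IsTransverseHolomorphicSymplectic Ω)
    (hinv : ∀ g : G, TwoForm.pullback (fun x : C => g • x) Ω = Ω)
    {ι : Z → C} (hι : ContMDiff 𝓘(ℝ, F) 𝓘(ℝ, E) ∞ ι)
    (hinj : ∀ z, Function.Injective (mfderiv 𝓘(ℝ, F) 𝓘(ℝ, E) ι z))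
    (hιG : ∀ (g : G) z, ι (g • z) = g • ι z)
    (hfree : ∀ (z : Z) (g : G), g • z = z → g = 1)
    (hS : ∀ z, ∀ u : E, (∃ v : F, (mfderiv 𝓘(ℝ, F) 𝓘(ℝ, E) ι z v : E) = u) ↔
      ∀ a : EG, Ω (ι z) ![infinitesimalAction (EG := EG) (G := G) (E := E) a (ι z), u] = 0)
    {Q : Type*} [TopologicalSpace Q] {q : Z → Q} (hq : IsOpenQuotientMap q)
    (hqG : ∀ z z', q z = q z' ↔ ∃ g : G, g • z = z') :
    ∃ (d : ℕ) (_ : ChartedSpace (EuclideanSpace ℝ (Fin d)) Q)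
      (_ : IsManifold 𝓘(ℝ, EuclideanSpace ℝ (Fin d)) ∞ Q),
      Manifold.IsSubmersion 𝓘(ℝ, F) 𝓘(ℝ, EuclideanSpace ℝ (Fin d)) ∞ q ∧
      ∃ Ωred : TwoForm (EuclideanSpace ℝ (Fin d)) Q,
        IsTransverseHolomorphicSymplectic Ωred ∧
        ∀ Ω' : TwoForm (EuclideanSpace ℝ (Fin d)) Q,
          TwoForm.pullback (E := F) q Ω' = TwoForm.pullback (E := F) ι Ω ↔ Ω' = Ωred := by
  have hιd : MDifferentiable 𝓘(ℝ, F) 𝓘(ℝ, E) ι := hι.mdifferentiable (by simp)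
  -- The truncated subtraction is a true one as soon as Z has a point, because the orbit map there
  -- has injective derivative. For empty Z the equality may fail, so it takes a point as argument.
  have hdim : ∀ _ : Z, finrank ℝ (EuclideanSpace ℝ (Fin (finrank ℝ F - finrank ℝ EG))) +
      finrank ℝ EG = finrank ℝ F := by
    intro z
    let χ : EG →ₗ[ℝ] F := (mfderiv 𝓘(ℝ, EG) 𝓘(ℝ, F) (fun g : G => g • z) 1).toLinearMap
    have hχ : Function.Injective χ := mfderiv_orbitMap_injective (hfree z)
    have := LinearMap.finrank_le_finrank_of_injective hχ
    rw [finrank_euclideanSpace_fin]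
    omega
  have hsmul : ∀ g : G, ContMDiff 𝓘(ℝ, F) 𝓘(ℝ, F) ∞ (fun z : Z => g • z) := fun g =>
    ContMDiff.smul (I := 𝓘(ℝ, EG)) (I' := 𝓘(ℝ, F)) (f := fun _ : Z => g)
      contMDiff_const contMDiff_id
  have hsmulC : ∀ g : G, ContMDiff 𝓘(ℝ, E) 𝓘(ℝ, E) ∞ (fun x : C => g • x) := fun g =>
    ContMDiff.smul (I := 𝓘(ℝ, EG)) (I' := 𝓘(ℝ, E)) (f := fun _ : C => g)
      contMDiff_const contMDiff_id
  obtain ⟨_, hQ, hsub⟩ := exists_quotient_manifold (E := F)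
    (N := EuclideanSpace ℝ (Fin (finrank ℝ F - finrank ℝ EG))) (K := EG) hq
    (fun z z' h => by
      obtain ⟨g, rfl⟩ := (hqG z z').1 h
      exact ⟨fun z => g • z, hsmul g, rfl, fun w => ((hqG _ _).2 ⟨g, rfl⟩).symm⟩)
    (fun z => exists_isAdaptedChart hqG (hdim z) z (hfree z))
    (fun ⟨z⟩ => ⟨ContinuousLinearEquiv.ofFinrankEq (by rw [finrank_prod, hdim z])⟩)
  have hqd : MDifferentiable 𝓘(ℝ, F) 𝓘(ℝ, EuclideanSpace ℝ (Fin (finrank ℝ F - finrank ℝ EG))) q :=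
    fun z => (hsub z).contMDiffAt.mdifferentiableAt (by simp)
  have hdq := fun z => mfderiv_surjective_of_isSubmersionAt (hsub z)
  have hχ := fun a z => mfderiv_infinitesimalAction (EG := EG) hιd hιG a z
  obtain ⟨Ωred, hred⟩ := TwoForm.exists_pullback_eq hq.surjective hqd hdq
    (Θ := TwoForm.pullback (E := F) ι Ω)
    (by
      intro z u hu v
      -- A vertical vector is an infinitesimal action, and `hS` says that every vector tangent to Z
      -- is Ω-orthogonal to those.
      obtain ⟨a, rfl⟩ := (mfderiv_quotient_eq_zero_iff (EG := EG) (G := G) (hfree z)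
        (fun g => ((hqG _ _).2 ⟨g, rfl⟩).symm) (hdim z) (hqd z) (hdq z) u).1 hu
      refine (TwoForm.pullback_apply ι Ω z _ v).trans ?_
      have := (hS z _).1 ⟨v, rfl⟩ a
      rw [← hχ] at this
      exact this)
    (fun z z' h => by
      obtain ⟨g, rfl⟩ := (hqG z z').1 h
      exact ⟨fun z => g • z, (hsmul g).mdifferentiable (by simp), rfl,
        fun w => ((hqG _ _).2 ⟨g, rfl⟩).symm,
        TwoForm.pullback_pullback_of_comp_eq hιd ((hsmul g).mdifferentiable (by simp))
          ((hsmulC g).mdifferentiable (by simp)) (funext fun z => hιG g z) (hinv g)⟩)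
  refine ⟨_, _, hQ, hsub.isSubmersion, Ωred, ?_, fun Ω' => ⟨fun h => ?_, ?_⟩⟩
  · let A : Z → Submodule ℝ E := fun z => LinearMap.range
      (mfderiv 𝓘(ℝ, EG) 𝓘(ℝ, E) (fun g : G => g • ι z) 1).toLinearMap
    refine hΩ.of_pullback_eq hι hinj hsub hq.surjective A ?_ ?_ hred
    · rintro z _ ⟨a, rfl⟩
      exact ⟨_, hχ a z⟩
    · intro z u
      rw [hS]
      constructor
      · rintro h _ ⟨a, rfl⟩
        exact h a
      · exact fun h a => h _ ⟨a, rfl⟩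
  · exact TwoForm.pullback_injective hq.surjective hdq (h.trans hred.symm)
  · rintro rfl
    exact hred

end Reduction

end BraneReduction
end

/-! ### Reduction of the zero level of the moment map -/

theorem theorem4p2
    {EG : Type*} [NormedAddCommGroup EG] [NormedSpace ℝ EG] [FiniteDimensional ℝ EG]
    {G : Type*} [TopologicalSpace G] [ChartedSpace EG G] [Group G] [LieGroup 𝓘(ℝ, EG) ∞ G]
    [CompactSpace G] [ConnectedSpace G]
    {E : Type*} [NormedAddCommGroup E] [NormedSpace ℝ E] [FiniteDimensional ℝ E]
    {C : Type*} [TopologicalSpace C] [T2Space C] [SecondCountableTopology C]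
    [ChartedSpace E C] [IsManifold 𝓘(ℝ, E) ∞ C]
    [MulAction G C] [ContMDiffSMul 𝓘(ℝ, EG) 𝓘(ℝ, E) ∞ G C]
    (Ω : TwoForm E C) (hΩ : IsTransverseHolomorphicSymplectic Ω)
    (ν : C → (EG →L[ℝ] ℂ)) (hν : IsHamiltonianAction G Ω ν)
    (hfree : ∀ x ∈ ν ⁻¹' {0}, ∀ g : G, g • x = x → g = 1)
    {F : Type*} [NormedAddCommGroup F] [NormedSpace ℝ F] [FiniteDimensional ℝ F]
    [ChartedSpace F (ν ⁻¹' {0})] (hclean : IsCleanValue (E := E) (E' := EG →L[ℝ] ℂ) F ν 0) :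
    T2Space (OrbitSpace G (ν ⁻¹' {0})) ∧
    SecondCountableTopology (OrbitSpace G (ν ⁻¹' {0})) ∧
    ∃ (d : ℕ) (_ : ChartedSpace (EuclideanSpace ℝ (Fin d)) (OrbitSpace G (ν ⁻¹' {0})))
      (_ : IsManifold 𝓘(ℝ, EuclideanSpace ℝ (Fin d)) ∞ (OrbitSpace G (ν ⁻¹' {0}))),
      Manifold.IsSubmersion 𝓘(ℝ, F) 𝓘(ℝ, EuclideanSpace ℝ (Fin d)) ∞
        (orbitMap G (ν ⁻¹' {0})) ∧
      ∃ Ωred : TwoForm (EuclideanSpace ℝ (Fin d)) (OrbitSpace G (ν ⁻¹' {0})),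
        IsTransverseHolomorphicSymplectic Ωred ∧
        ∀ Ω' : TwoForm (EuclideanSpace ℝ (Fin d)) (OrbitSpace G (ν ⁻¹' {0})),
          TwoForm.pullback (E := F) (orbitMap G (ν ⁻¹' {0})) Ω' =
            TwoForm.pullback (E := F) (Subtype.val : (ν ⁻¹' {0}) → C) Ω ↔ Ω' = Ωred := by
  have : IsManifold 𝓘(ℝ, F) ∞ (ν ⁻¹' {0}) := hclean.isManifold
  have himm := hclean.isSmoothEmbedding.isImmersion
  have hι : ContMDiff 𝓘(ℝ, F) 𝓘(ℝ, E) ∞ (Subtype.val : (ν ⁻¹' {0}) → C) := himm.contMDiff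
  have hinv : ∀ (g : G) (x : C), x ∈ ν ⁻¹' {0} → g • x ∈ ν ⁻¹' {0} := by
    intro g x hx
    refine ContinuousLinearMap.ext fun a => (hν.equivariant g x a).trans ?_
    rw [show ν x = 0 from hx]
    rfl
  let _ : MulAction G (ν ⁻¹' {0}) :=
    { smul := fun g z => ⟨g • (z : C), hinv g z z.2⟩
      one_smul := fun z => Subtype.ext (one_smul G (z : C))
      mul_smul := fun g h z => Subtype.ext (mul_smul g h (z : C)) }
  have hsmul : ContMDiffSMul 𝓘(ℝ, EG) 𝓘(ℝ, F) ∞ G (ν ⁻¹' {0}) := by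
    have h : ContMDiff (𝓘(ℝ, EG).prod 𝓘(ℝ, F)) 𝓘(ℝ, E) ∞
        (fun p : G × (ν ⁻¹' {0}) => p.1 • (p.2 : C)) :=
      ContMDiff.smul contMDiff_fst (hι.comp contMDiff_snd)
    -- A continuous map into the level set is smooth once its composite with the immersion into C is
    -- smooth; continuity comes from the subspace topology.
    exact ⟨(ContMDiff.iff_comp_isImmersion himm).2 ⟨h.continuous.subtype_mk _, h⟩⟩
  have : ContinuousSMul G (ν ⁻¹' {0}) :=
    ContMDiffSMul.continuousSMul (I := 𝓘(ℝ, EG)) (I' := 𝓘(ℝ, F)) ∞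
  have hqG : ∀ z z' : (ν ⁻¹' {0}), orbitMap G (ν ⁻¹' {0}) z = orbitMap G (ν ⁻¹' {0}) z' ↔
      ∃ g : G, g • z = z' := by
    intro z z'
    -- The orbit relation between x and y reads g • y = x, hence the flip.
    refine eq_comm.trans (Quotient.eq.trans ?_)
    change (∃ g : G, g • (z : C) = z') ↔ _
    exact exists_congr fun g => ⟨fun h => Subtype.ext h, fun h => congrArg Subtype.val h⟩
  have hq : IsOpenQuotientMap (orbitMap G (ν ⁻¹' {0})) :=
    isOpenQuotientMap_of_fibers_eq_orbits isQuotientMap_quot_mk hqG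
  refine ⟨t2Space_of_fibers_eq_orbits hq hqG,
    hq.isQuotientMap.secondCountableTopology hq.isOpenMap, ?_⟩
  refine exists_reduction (EG := EG) (G := G) hΩ hν.invariant hι (fun z => ?_) (fun _ _ => rfl)
    (fun z g hg => hfree z z.2 g (Subtype.ext_iff.1 hg)) (fun z u => ?_) hq hqG
  · obtain ⟨K, _, _, hK⟩ := himm.isImmersionAt z
    exact mfderiv_injective_of_isImmersionAt hK
  -- Cleanness identifies the tangent vectors of the level set with ker dν, and the moment identity
  -- turns dν(u) = 0 into Ω-orthogonality to all infinitesimal actions.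
  · refine Iff.trans (SetLike.ext_iff.1 (hclean.range_eq_ker z) u) ?_
    constructor
    · intro h a
      refine (hν.moment a z u).trans ?_
      exact congrArg (fun f : EG →L[ℝ] ℂ => f a) h
    · intro h
      exact ContinuousLinearMap.ext fun a => (hν.moment a z u).symm.trans (h a)
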